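/- Let $A$ be a unital $C^*$-algebra and let $u,v\in A$ be unitaries such that $\|uv-vu\|<2$ and such that $uvu^*v^*$ commutes with $u$ and with $v$. Let $A_{u,v}$ be the $C^*$-subalgebra of $A$ generated by $u$ and $v$. For $\theta\in\mathbb{R}$ let $A_\theta$ denote the rotation algebra, i.e. the universal unital $C^*$-algebra generated by two unitaries $u_\theta,v_\theta$ subject to the relation $u_\theta v_\theta=e^{2\pi i\theta}v_\theta u_\theta$. If $A_{u,v}$ has exactly one tracial state (a positive linear functional $\tau$ with $\tau(1)=1$ and $\tau(ab)=\tau(ba)$ for all $a,b$), then either $A_{u,v}$ is $*$-isomorphic to $A_\theta$ for some irrational number $\theta$, or $A_{u,v}$ is $*$-isomorphic to the matrix algebra $M_n(\mathbb{C})$ for some integer $n\ge 1$. -/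

import Mathlib

open scoped ComplexOrder

noncomputable section

/-- The C⋆-subalgebra of `A` generated by `u` and `v` (together with the unit of `A`, which for
unitary `u` lies in the C⋆-algebra generated by `u` anyway). -/
def generatedCStar {A : Type*} [CStarAlgebra A] (u v : A) : StarSubalgebra ℂ A :=
  (StarAlgebra.adjoin ℂ {u, v}).topologicalClosure

/-- A tracial state: a positive linear functional `τ` with `τ 1 = 1` and `τ (a b) = τ (b a)`. -/
structure IsTracialState {B : Type*} [Ring B] [StarRing B] [Algebra ℂ B] (τ : B →ₗ[ℂ] ℂ) :
    Prop where
  nonneg : ∀ a : B, 0 ≤ τ (star a * a)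
  map_one : τ 1 = 1
  map_mul_comm : ∀ a b : B, τ (a * b) = τ (b * a)

/-- The free unital ⋆-algebra on two unitaries, that is, the complex group algebra of the free
group on two generators. The parameter `θ` only serves to carry the seminorm defined below. -/
def FreeUnitaryPair (_θ : ℝ) : Type := MonoidAlgebra ℂ (FreeGroup (Fin 2))

namespace FreeUnitaryPair

variable {θ : ℝ}

instance : Ring (FreeUnitaryPair θ) := inferInstanceAs (Ring (MonoidAlgebra ℂ (FreeGroup (Fin 2))))

instance : Algebra ℂ (FreeUnitaryPair θ) :=
  inferInstanceAs (Algebra ℂ (MonoidAlgebra ℂ (FreeGroup (Fin 2))))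

/-- The scalar multiple `c g` of a group element `g`. -/
def single (θ : ℝ) (g : FreeGroup (Fin 2)) (c : ℂ) : FreeUnitaryPair θ := MonoidAlgebra.single g c

/-- The first generating unitary. -/
def genU (θ : ℝ) : FreeUnitaryPair θ := single θ (FreeGroup.of 0) 1

/-- The second generating unitary. -/
def genV (θ : ℝ) : FreeUnitaryPair θ := single θ (FreeGroup.of 1) 1

lemma single_mul_single (g h : FreeGroup (Fin 2)) (c d : ℂ) :
    single θ g c * single θ h d = single θ (g * h) (c * d) :=
  MonoidAlgebra.single_mul_single ..

lemma one_def : (1 : FreeUnitaryPair θ) = single θ 1 1 := rfl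

lemma smul_single (a : ℂ) (g : FreeGroup (Fin 2)) (c : ℂ) :
    a • single θ g c = single θ g (a * c) :=
  MonoidAlgebra.smul_single ..

@[elab_as_elim]
lemma induction_single {P : FreeUnitaryPair θ → Prop} (x : FreeUnitaryPair θ) (h0 : P 0)
    (hs : ∀ g c, P (single θ g c)) (ha : ∀ x y, P x → P y → P (x + y)) : P x :=
  MonoidAlgebra.induction_linear x h0 ha hs

/-- The conjugate-linear involution with `g ↦ g⁻¹` on group elements. -/
def starHomAux : MonoidAlgebra ℂ (FreeGroup (Fin 2)) →+ MonoidAlgebra ℂ (FreeGroup (Fin 2)) where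
  toFun x := MonoidAlgebra.mapDomain (fun g => g⁻¹)
    (MonoidAlgebra.map ((starRingEnd ℂ : ℂ →+* ℂ) : ℂ →+ ℂ) x)
  map_zero' := by simp
  map_add' x y := by rw [MonoidAlgebra.map_add, MonoidAlgebra.mapDomain_add]

lemma starHomAux_single (g : FreeGroup (Fin 2)) (c : ℂ) :
    starHomAux (MonoidAlgebra.single g c) = MonoidAlgebra.single g⁻¹ (star c) := by
  simp [starHomAux]

/-- The same involution on `FreeUnitaryPair θ`. -/
def starHom : FreeUnitaryPair θ →+ FreeUnitaryPair θ := starHomAux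

lemma starHom_single (g : FreeGroup (Fin 2)) (c : ℂ) :
    starHom (single θ g c) = single θ g⁻¹ (star c) := starHomAux_single g c

instance : StarRing (FreeUnitaryPair θ) where
  star := starHom
  star_add := map_add starHom
  star_involutive x := by
    show starHom (starHom x) = x
    refine induction_single x ?_ ?_ ?_
    · simp
    · intro g c
      simp [starHom_single]
    · intro x y hx hy
      rw [map_add, map_add, hx, hy]
  star_mul x y := by
    show starHom (x * y) = starHom y * starHom x
    refine induction_single x ?_ ?_ ?_
    · simp
    · intro g c
      refine induction_single y ?_ ?_ ?_
      · simp
      · intro h d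
        simp [single_mul_single, starHom_single, mul_comm]
      · intro y z hy hz
        rw [mul_add, map_add, map_add, hy, hz, add_mul]
    · intro x z hx hz
      rw [add_mul, map_add, map_add, hx, hz, mul_add]

lemma star_single (g : FreeGroup (Fin 2)) (c : ℂ) :
    star (single θ g c) = single θ g⁻¹ (star c) := starHom_single g c

instance : StarModule ℂ (FreeUnitaryPair θ) where
  star_smul a x := by
    refine induction_single x ?_ ?_ ?_
    · simp
    · intro g c
      simp [smul_single, star_single]
    · intro x y hx hy
      rw [smul_add, star_add, hx, hy, star_add, smul_add]

/-- The C⋆-seminorms `p` on the free ⋆-algebra on two unitaries `U`, `V` in which the relation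
`U V = e^{2πiθ} V U` holds. These are precisely the functions `x ↦ ‖φ x‖` for the unital
⋆-homomorphisms `φ` to unital C⋆-algebras such that `φ U φ V = e^{2πiθ} φ V φ U`. -/
structure IsRotationSeminorm (p : Seminorm ℂ (FreeUnitaryPair θ)) : Prop where
  mul_le : ∀ x y, p (x * y) ≤ p x * p y
  star_mul_self : ∀ x, p (star x * x) = p x ^ 2
  relation : p (genU θ * genV θ -
    Complex.exp (2 * Real.pi * Complex.I * θ) • (genV θ * genU θ)) = 0

lemma IsRotationSeminorm.star_eq {p : Seminorm ℂ (FreeUnitaryPair θ)} (hp : IsRotationSeminorm p)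
    (x : FreeUnitaryPair θ) : p (star x) = p x := by
  have key : ∀ y, p y ≤ p (star y) := fun y => by
    by_contra! h
    have h1 := hp.star_mul_self y
    have h2 := hp.mul_le (star y) y
    nlinarith [apply_nonneg p (star y), apply_nonneg p y]
  exact le_antisymm (by simpa using key (star x)) (key x)

lemma exists_bound (x : FreeUnitaryPair θ) :
    ∃ C : ℝ, ∀ p : Seminorm ℂ (FreeUnitaryPair θ), IsRotationSeminorm p → p x ≤ C := by
  refine induction_single x ?_ ?_ ?_
  · exact ⟨0, fun p _ => by simp⟩
  · intro g c
    refine ⟨‖c‖, fun p hp => ?_⟩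
    have e : single θ g c = c • single θ g 1 := by simp [smul_single]
    have h1 : p 1 ≤ 1 := by
      have h := hp.star_mul_self 1
      simp only [star_one, one_mul] at h
      nlinarith [apply_nonneg p (1 : FreeUnitaryPair θ)]
    have h2 := hp.star_mul_self (single θ g 1)
    rw [star_single, single_mul_single] at h2
    simp only [inv_mul_cancel, star_one, one_mul, ← one_def] at h2
    have h3 : p (single θ g 1) ≤ 1 := by
      nlinarith [apply_nonneg p (single θ g 1)]
    rw [e, map_smul_eq_mul]
    nlinarith [norm_nonneg c]
  · rintro x y ⟨C, hC⟩ ⟨D, hD⟩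
    exact ⟨C + D, fun p hp => (map_add_le_add p x y).trans (add_le_add (hC p hp) (hD p hp))⟩

/-- The universal C⋆-seminorm: the supremum of all C⋆-seminorms satisfying the relation. -/
def univNorm (x : FreeUnitaryPair θ) : ℝ :=
  ⨆ p : {p : Seminorm ℂ (FreeUnitaryPair θ) // IsRotationSeminorm p}, p.1 x

lemma isRotationSeminorm_zero : IsRotationSeminorm (0 : Seminorm ℂ (FreeUnitaryPair θ)) :=
  ⟨by simp, by simp, by simp⟩

instance : Nonempty {p : Seminorm ℂ (FreeUnitaryPair θ) // IsRotationSeminorm p} :=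
  ⟨⟨0, isRotationSeminorm_zero⟩⟩

lemma le_univNorm {p : Seminorm ℂ (FreeUnitaryPair θ)} (hp : IsRotationSeminorm p)
    (x : FreeUnitaryPair θ) : p x ≤ univNorm x := by
  obtain ⟨C, hC⟩ := exists_bound x
  exact le_ciSup (f := fun p : {p : Seminorm ℂ (FreeUnitaryPair θ) // IsRotationSeminorm p} =>
    p.1 x) ⟨C, by rintro _ ⟨q, rfl⟩; exact hC q.1 q.2⟩ ⟨p, hp⟩

lemma univNorm_le {x : FreeUnitaryPair θ} {C : ℝ}
    (h : ∀ p : Seminorm ℂ (FreeUnitaryPair θ), IsRotationSeminorm p → p x ≤ C) :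
    univNorm x ≤ C :=
  ciSup_le fun p => h p.1 p.2

lemma univNorm_nonneg (x : FreeUnitaryPair θ) : 0 ≤ univNorm x :=
  (apply_nonneg _ x).trans (le_univNorm isRotationSeminorm_zero x)

instance : Norm (FreeUnitaryPair θ) := ⟨univNorm⟩

instance : SeminormedRing (FreeUnitaryPair θ) :=
  { SeminormedAddCommGroup.ofCore (𝕜 := ℂ) (E := FreeUnitaryPair θ)
      { norm_nonneg := univNorm_nonneg
        norm_smul := fun c x => by
          have h : ∀ (c : ℂ) (x : FreeUnitaryPair θ), univNorm (c • x) ≤ ‖c‖ * univNorm x :=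
            fun c x => univNorm_le fun p hp => by
              rw [map_smul_eq_mul]
              exact mul_le_mul_of_nonneg_left (le_univNorm hp x) (norm_nonneg c)
          refine le_antisymm (h c x) ?_
          by_cases hc : c = 0
          · subst hc
            rw [norm_zero, zero_mul]
            exact univNorm_nonneg _
          · have h2 := h c⁻¹ (c • x)
            rw [inv_smul_smul₀ hc, norm_inv, inv_mul_eq_div, le_div_iff₀ (norm_pos_iff.2 hc)] at h2
            rw [mul_comm]
            exact h2
        norm_triangle := fun x y => univNorm_le fun p hp =>
          (map_add_le_add p x y).trans (add_le_add (le_univNorm hp x) (le_univNorm hp y)) },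
    (inferInstance : Ring (FreeUnitaryPair θ)) with
    norm_mul_le := fun x y => univNorm_le fun p hp => (hp.mul_le x y).trans
      (mul_le_mul (le_univNorm hp x) (le_univNorm hp y) (apply_nonneg _ _) (univNorm_nonneg _)) }

lemma norm_def (x : FreeUnitaryPair θ) : ‖x‖ = univNorm x := rfl

lemma norm_star_eq (x : FreeUnitaryPair θ) : ‖star x‖ = ‖x‖ := by
  have h : ∀ y : FreeUnitaryPair θ, ‖star y‖ ≤ ‖y‖ := fun y => univNorm_le fun p hp => by
    rw [hp.star_eq]
    exact le_univNorm hp y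
  exact le_antisymm (h x) (by simpa using h (star x))

lemma norm_mul_self_le (x : FreeUnitaryPair θ) : ‖x‖ * ‖x‖ ≤ ‖star x * x‖ := by
  rw [← sq, ← Real.le_sqrt (norm_nonneg _) (norm_nonneg _)]
  refine univNorm_le fun p hp => Real.le_sqrt_of_sq_le ?_
  rw [← hp.star_mul_self]
  exact le_univNorm hp _

instance : NormedAlgebra ℂ (FreeUnitaryPair θ) where
  norm_smul_le c x := univNorm_le fun p hp => by
    rw [map_smul_eq_mul]
    exact mul_le_mul_of_nonneg_left (le_univNorm hp x) (norm_nonneg c)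

instance : NormedStarGroup (FreeUnitaryPair θ) where
  norm_star_le x := (norm_star_eq x).le

end FreeUnitaryPair

/-- The rotation algebra `A_θ`: the universal C⋆-algebra generated by two unitaries `U`, `V`
subject to `U V = e^{2πiθ} V U`, that is, the Hausdorff completion of the free ⋆-algebra on two
unitaries with respect to the universal C⋆-seminorm. -/
def RotationAlgebra (θ : ℝ) : Type := UniformSpace.Completion (FreeUnitaryPair θ)

namespace RotationAlgebra

open UniformSpace

variable {θ : ℝ}

instance : NormedRing (RotationAlgebra θ) :=
  inferInstanceAs (NormedRing (Completion (FreeUnitaryPair θ)))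

instance : CompleteSpace (RotationAlgebra θ) :=
  inferInstanceAs (CompleteSpace (Completion (FreeUnitaryPair θ)))

instance : Algebra ℂ (RotationAlgebra θ) :=
  inferInstanceAs (Algebra ℂ (Completion (FreeUnitaryPair θ)))

instance : NormedAlgebra ℂ (RotationAlgebra θ) where
  norm_smul_le c x := norm_smul_le (β := Completion (FreeUnitaryPair θ)) c x

/-- The canonical map from the free ⋆-algebra on two unitaries. -/
def mk (x : FreeUnitaryPair θ) : RotationAlgebra θ := (x : Completion (FreeUnitaryPair θ))

lemma continuous_mk : Continuous (mk : FreeUnitaryPair θ → RotationAlgebra θ) :=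
  Completion.continuous_coe _

lemma denseRange_mk : DenseRange (mk : FreeUnitaryPair θ → RotationAlgebra θ) :=
  Completion.denseRange_coe

lemma mk_add (x y : FreeUnitaryPair θ) : mk (x + y) = mk x + mk y := Completion.coe_add x y

lemma mk_mul (x y : FreeUnitaryPair θ) : mk (x * y) = mk x * mk y := Completion.coe_mul x y

lemma mk_smul (c : ℂ) (x : FreeUnitaryPair θ) : mk (c • x) = c • mk x := Completion.coe_smul c x

lemma norm_mk (x : FreeUnitaryPair θ) : ‖mk x‖ = ‖x‖ := Completion.norm_coe x

/-- The involution, extended by continuity. -/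
instance : Star (RotationAlgebra θ) :=
  ⟨Completion.map (star : FreeUnitaryPair θ → FreeUnitaryPair θ)⟩

lemma uniformContinuous_star_pre :
    UniformContinuous (star : FreeUnitaryPair θ → FreeUnitaryPair θ) :=
  uniformContinuous_addMonoidHom_of_continuous (f := (starAddEquiv : FreeUnitaryPair θ ≃+ _))
    continuous_star

lemma continuous_star' : Continuous (star : RotationAlgebra θ → RotationAlgebra θ) :=
  Completion.continuous_map

lemma mk_star (x : FreeUnitaryPair θ) : mk (star x) = star (mk x) :=
  (Completion.map_coe uniformContinuous_star_pre x).symm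

instance : StarRing (RotationAlgebra θ) where
  star_involutive x := by
    refine denseRange_mk.induction_on x
      (isClosed_eq (continuous_star'.comp continuous_star') continuous_id) fun a => ?_
    rw [← mk_star, ← mk_star, star_star]
  star_mul x y := by
    refine denseRange_mk.induction_on₂ (p := fun x y => star (x * y) = star y * star x)
      (isClosed_eq (continuous_star'.comp continuous_mul)
      ((continuous_star'.comp continuous_snd).mul (continuous_star'.comp continuous_fst)))
      (fun a b => ?_) x y
    rw [← mk_mul, ← mk_star, star_mul, mk_mul, mk_star, mk_star]
  star_add x y := by
    refine denseRange_mk.induction_on₂ (p := fun x y => star (x + y) = star x + star y)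
      (isClosed_eq (continuous_star'.comp continuous_add)
      ((continuous_star'.comp continuous_fst).add (continuous_star'.comp continuous_snd)))
      (fun a b => ?_) x y
    rw [← mk_add, ← mk_star, star_add, mk_add, mk_star, mk_star]

/-- `A_θ` is a unital C⋆-algebra. -/
instance : CStarAlgebra (RotationAlgebra θ) where
  norm_mul_self_le x := by
    refine denseRange_mk.induction_on x
      (isClosed_le (continuous_norm.mul continuous_norm)
        (continuous_norm.comp (continuous_star'.mul continuous_id))) fun a => ?_
    show ‖mk a‖ * ‖mk a‖ ≤ ‖star (mk a) * mk a‖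
    rw [← mk_star, ← mk_mul, norm_mk, norm_mk]
    exact FreeUnitaryPair.norm_mul_self_le a
  star_smul c x := by
    refine denseRange_mk.induction_on x
      (isClosed_eq (continuous_star'.comp (continuous_const_smul c))
        (continuous_star'.const_smul (star c))) fun a => ?_
    rw [← mk_smul, ← mk_star, star_smul, mk_smul, mk_star]

end RotationAlgebra

end

/-
Write `B` for the C⋆-algebra generated by `u` and `v`, and let `c` be a central unitary of `B`. The
states of `B` taking a prescribed spectral value at `c` form a nonempty weak-* compact convex set
which is invariant under conjugation by `u` and by `v`. As `uvu⋆v⋆` is central, the two conjugations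
commute on functionals, so by Markov–Kakutani they have a common fixed point, which is a tracial
state. Hence a unique trace forces the spectrum of `c` to be a point, that is, `c` to be scalar; in
particular `uv = ω vu` for some `ω` on the unit circle.

If `ω` has finite order `n`, then `uⁿ` and `vⁿ` are central, hence scalar, and after rescaling `u`
and `v` to make them `1`, the elements `vⁱ p v⁻ʲ`, with `p` the eigenprojection of `u` at `1`, are
matrix units for `B`. If `ω` has infinite order, a trace vanishes on every monomial `uʲvᵏ` other
than `1`, so the monomials are orthonormal for it, and Cauchy–Schwarz bounds the norm in `A_θ` of a
Laurent polynomial `x` of degree `D` by `2D + 1` times the norm of its image in `B`. Replacing `x`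
by its powers removes the polynomial factor, so that `A_θ → B` is isometric.
-/

open Filter Topology
open scoped commutatorElement

section FixedPoint

variable {V : Type*} [AddCommGroup V] [Module ℝ V] [TopologicalSpace V] [IsTopologicalAddGroup V]
  [ContinuousSMul ℝ V] [T2Space V]

theorem exists_map_eq_self_of_mapsTo {K : Set V} (hKc : IsCompact K) (hKconv : Convex ℝ K)
    (hKne : K.Nonempty) (T : V →L[ℝ] V) (hT : Set.MapsTo T K K) : ∃ x ∈ K, T x = x := by
  obtain ⟨x₀, hx₀⟩ := hKne
  have iterate_mem (k : ℕ) : T^[k] x₀ ∈ K := hT.iterate k hx₀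
  let mean (N : ℕ) : V := ∑ k ∈ Finset.range (N + 1), ((N : ℝ) + 1)⁻¹ • T^[k] x₀
  have mean_mem (N : ℕ) : mean N ∈ K :=
    hKconv.sum_mem (fun _ _ ↦ by positivity) (by simp; field_simp) fun k _ ↦ iterate_mem k
  have map_mean_sub (N : ℕ) : T (mean N) - mean N = ((N : ℝ) + 1)⁻¹ • (T^[N + 1] x₀ - x₀) := by
    simp_rw [mean, ← Finset.smul_sum, map_smul, ← smul_sub, map_sum, ← Function.iterate_succ_apply',
      ← Finset.sum_sub_distrib, Finset.sum_range_sub (fun k ↦ T^[k] x₀) (N + 1),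
      Function.iterate_zero_apply]
  have tendsto_zero : Tendsto (fun N ↦ T (mean N) - mean N) atTop (𝓝 0) := by
    simp_rw [map_mean_sub]
    refine (hKc.isVonNBounded ℝ |>.sub (hKc.isVonNBounded ℝ)).smul_tendsto_zero
      (.of_forall fun N ↦ Set.sub_mem_sub (iterate_mem (N + 1)) hx₀) ?_
    simpa only [one_div] using tendsto_one_div_add_atTop_nhds_zero_nat (𝕜 := ℝ)
  obtain ⟨x, hxK, hx⟩ := hKc.exists_mapClusterPt (f := atTop)
    (tendsto_principal.2 (Eventually.of_forall mean_mem))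
  have cluster : MapClusterPt (T x - x) atTop fun N ↦ T (mean N) - mean N :=
    hx.continuousAt_comp (f := fun y ↦ T y - y) (by fun_prop)
  exact ⟨x, hxK, sub_eq_zero.1 (eq_of_nhds_neBot (cluster.clusterPt.mono tendsto_zero).neBot)⟩

theorem exists_map_eq_self_of_commute {S T : V →L[ℝ] V} (hST : Commute S T) {K : Set V}
    (hKc : IsCompact K) (hKconv : Convex ℝ K) (hKne : K.Nonempty) (hS : Set.MapsTo S K K)
    (hT : Set.MapsTo T K K) : ∃ x ∈ K, S x = x ∧ T x = x := by
  have hconv : Convex ℝ (K ∩ {x | S x = x}) :=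
    hKconv.inter (LinearMap.eqLocus (S : V →ₗ[ℝ] V) LinearMap.id).convex
  have hcomp : IsCompact (K ∩ {x | S x = x}) :=
    hKc.inter_right (isClosed_eq S.continuous continuous_id)
  have hmaps : Set.MapsTo T (K ∩ {x | S x = x}) (K ∩ {x | S x = x}) := fun x ⟨hxK, hx⟩ ↦
    ⟨hT hxK, (DFunLike.congr_fun hST.eq x).trans (congrArg T hx)⟩
  obtain ⟨x, ⟨hxK, hxS⟩, hxT⟩ := exists_map_eq_self_of_mapsTo hcomp hconv
    (exists_map_eq_self_of_mapsTo hKc hKconv hKne S hS) T hmaps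
  exact ⟨x, hxK, hxS, hxT⟩

end FixedPoint

section States

variable {B : Type*} [CStarAlgebra B]

/-- The states of `B`, as a subset of the weak-* dual: the contractive functionals taking the value
`1` at `1`. For a C⋆-algebra these are the positive functionals of norm one. -/
def stateSpace (B : Type*) [CStarAlgebra B] : Set (WeakDual ℂ B) :=
  WeakDual.toStrongDual ⁻¹' Metric.closedBall 0 1 ∩ {φ | φ 1 = 1}

lemma isCompact_stateSpace : IsCompact (stateSpace B) :=
  (WeakDual.isCompact_closedBall 0 1).inter_right
    (isClosed_eq (WeakDual.eval_continuous 1) continuous_const)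

lemma convex_stateSpace : Convex ℝ (stateSpace B) := fun φ hφ ψ hψ a b ha hb hab ↦ by
  refine ⟨convex_closedBall (0 : StrongDual ℂ B) 1 hφ.1 hψ.1 ha hb hab, ?_⟩
  change a • φ 1 + b • ψ 1 = 1
  rw [show φ 1 = 1 from hφ.2, show ψ 1 = 1 from hψ.2, ← add_smul, hab, one_smul]

lemma norm_add_algebraMap_mul_I_sq_le {h : B} (hh : IsSelfAdjoint h) (t : ℝ) :
    ‖h + algebraMap ℂ B (t * Complex.I)‖ ^ 2 ≤ ‖h‖ ^ 2 + t ^ 2 := by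
  rcases subsingleton_or_nontrivial B with _ | _
  · rw [Subsingleton.elim (h + _) h]
    exact le_add_of_nonneg_right (sq_nonneg t)
  set z : ℂ := t * Complex.I
  have star_z : star z = -z := by simp [z]
  have z_sq : z * z = -(t : ℂ) ^ 2 := by simp [z, ← sq, mul_pow]
  have star_mul_self : star (h + algebraMap ℂ B z) * (h + algebraMap ℂ B z)
      = h * h + algebraMap ℂ B (t ^ 2) := by
    rw [star_add, hh.star_eq, ← algebraMap_star_comm, star_z, map_neg, ← sub_eq_add_neg,
      ← (Algebra.commute_algebraMap_right z h).mul_self_sub_mul_self_eq', ← map_mul, z_sq, map_neg,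
      sub_neg_eq_add]
  calc ‖h + algebraMap ℂ B z‖ ^ 2 = ‖h * h + algebraMap ℂ B (t ^ 2)‖ := by
        rw [sq, ← CStarRing.norm_star_mul_self, star_mul_self]
    _ ≤ ‖h * h‖ + ‖algebraMap ℂ B (t ^ 2)‖ := norm_add_le _ _
    _ ≤ ‖h‖ * ‖h‖ + ‖(t ^ 2 : ℂ)‖ :=
        add_le_add (norm_mul_le _ _) (norm_algebraMap' B _).le
    _ = ‖h‖ ^ 2 + t ^ 2 := by simp [sq]

lemma norm_algebraMap_norm_sub_self_le [PartialOrder B] [StarOrderedRing B] {h : B} (hh : 0 ≤ h) :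
    ‖algebraMap ℝ B ‖h‖ - h‖ ≤ ‖h‖ := by
  rw [CStarAlgebra.norm_le_iff_le_algebraMap _ (norm_nonneg _)
    (sub_nonneg.2 hh.isSelfAdjoint.le_algebraMap_norm_self)]
  exact sub_le_self _ hh

namespace stateSpace

variable {φ : WeakDual ℂ B} (hφ : φ ∈ stateSpace B)

include hφ

lemma map_one : φ 1 = 1 := hφ.2

lemma map_algebraMap (z : ℂ) : φ (algebraMap ℂ B z) = z := by
  rw [Algebra.algebraMap_eq_smul_one, map_smul, map_one hφ, smul_eq_mul, mul_one]

lemma norm_apply_le (x : B) : ‖φ x‖ ≤ ‖x‖ :=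
  ((WeakDual.toStrongDual φ).le_of_opNorm_le (mem_closedBall_zero_iff.1 hφ.1) x).trans_eq
    (one_mul _)

lemma im_apply_eq_zero {h : B} (hh : IsSelfAdjoint h) : (φ h).im = 0 := by
  have bound (t : ℝ) : (φ h).re ^ 2 + ((φ h).im + t) ^ 2 ≤ ‖h‖ ^ 2 + t ^ 2 := by
    refine le_trans (le_of_eq ?_) ((pow_le_pow_left₀ (norm_nonneg _) (norm_apply_le hφ _) 2).trans
      (norm_add_algebraMap_mul_I_sq_le hh t))
    rw [map_add, map_algebraMap hφ, ← Complex.normSq_eq_norm_sq, Complex.normSq_apply]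
    simp [sq]
  by_contra hne
  have key : 2 * (φ h).im * ((‖h‖ ^ 2 + 1) / (2 * (φ h).im)) = ‖h‖ ^ 2 + 1 := by field_simp
  nlinarith [bound ((‖h‖ ^ 2 + 1) / (2 * (φ h).im)), sq_nonneg (φ h).re, sq_nonneg (φ h).im]

theorem apply_star_mul_self_nonneg (a : B) : 0 ≤ φ (star a * a) := by
  let := CStarAlgebra.spectralOrder B
  have := CStarAlgebra.spectralOrderedRing B
  set h := star a * a
  have bound : ‖(‖h‖ : ℂ) - φ h‖ ≤ ‖h‖ := by
    have := (norm_apply_le hφ _).trans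
      (norm_algebraMap_norm_sub_self_le (star_mul_self_nonneg a))
    rwa [map_sub, IsScalarTower.algebraMap_apply ℝ ℂ B, map_algebraMap hφ] at this
  have re_bound : ‖h‖ - (φ h).re ≤ ‖h‖ := (Complex.re_le_norm _).trans bound
  exact Complex.le_def.2
    ⟨by simpa using re_bound, (im_apply_eq_zero hφ (.star_mul_self a)).symm⟩

end stateSpace

lemma exists_mem_stateSpace_apply_eq {c : B} [IsStarNormal c] {μ : ℂ} (hμ : μ ∈ spectrum ℂ c) :
    ∃ φ ∈ stateSpace B, φ c = μ := by
  rcases subsingleton_or_nontrivial B with _ | _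
  · simp [spectrum.of_subsingleton] at hμ
  let S := StarAlgebra.elemental ℂ c
  let χ := (StarAlgebra.elemental.characterSpaceHomeo c).symm ⟨μ, hμ⟩
  have χ_apply : χ ⟨c, StarAlgebra.elemental.self_mem ℂ c⟩ = μ :=
    congrArg Subtype.val ((StarAlgebra.elemental.characterSpaceHomeo c).apply_symm_apply ⟨μ, hμ⟩)
  obtain ⟨ψ, ψ_apply, norm_ψ⟩ := exists_extension_norm_eq S.toSubalgebra.toSubmodule
    (WeakDual.toStrongDual (χ : WeakDual ℂ S))
  refine ⟨StrongDual.toWeakDual ψ, ⟨?_, ?_⟩, (ψ_apply ⟨c, _⟩).trans χ_apply⟩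
  · have := (StarAlgebra.elemental.isClosed ℂ c).completeSpace_coe
    refine mem_closedBall_zero_iff.2 (norm_ψ.trans_le ?_)
    exact (WeakDual.CharacterSpace.norm_le_norm_one χ).trans norm_one.le
  · exact (ψ_apply ⟨1, one_mem S⟩).trans (_root_.map_one χ)

end States

namespace generatedCStar

variable {B : Type*} [CStarAlgebra B]

lemma le_iff {u v : B} {S : StarSubalgebra ℂ B} (hS : IsClosed (S : Set B)) :
    generatedCStar u v ≤ S ↔ u ∈ S ∧ v ∈ S := by
  have h : generatedCStar u v ≤ S ↔ StarAlgebra.adjoin ℂ {u, v} ≤ S :=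
    ⟨(StarSubalgebra.le_topologicalClosure _).trans,
      fun h ↦ StarSubalgebra.topologicalClosure_minimal h hS⟩
  rw [h, StarAlgebra.adjoin_le_iff, Set.insert_subset_iff, Set.singleton_subset_iff]
  rfl

lemma isClosed {u v : B} : IsClosed (generatedCStar u v : Set B) :=
  StarSubalgebra.isClosed_topologicalClosure _

lemma left_mem {u v : B} : u ∈ generatedCStar u v := ((le_iff isClosed).1 le_rfl).1

lemma right_mem {u v : B} : v ∈ generatedCStar u v := ((le_iff isClosed).1 le_rfl).2

lemma le_smul_smul {u v : B} {a b : ℂ} (ha : a ≠ 0) (hb : b ≠ 0) :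
    generatedCStar u v ≤ generatedCStar (a • u) (b • v) := by
  refine (le_iff isClosed).2 ⟨?_, ?_⟩
  · simpa only [inv_smul_smul₀ ha] using
      StarSubalgebra.smul_mem _ (left_mem (u := a • u) (v := b • v)) a⁻¹
  · simpa only [inv_smul_smul₀ hb] using
      StarSubalgebra.smul_mem _ (right_mem (u := a • u) (v := b • v)) b⁻¹

lemma mem_of_eq_top {u v : B} (hgen : generatedCStar u v = ⊤) {S : StarSubalgebra ℂ B}
    (hS : IsClosed (S : Set B)) (hu : u ∈ S) (hv : v ∈ S) (x : B) : x ∈ S :=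
  (le_iff hS).2 ⟨hu, hv⟩ (hgen ▸ StarSubalgebra.mem_top)

lemma mem_center_of_commute {u v c : unitary B} (hgen : generatedCStar (u : B) v = ⊤)
    (hcu : Commute c u) (hcv : Commute c v) : (c : B) ∈ Set.center B := by
  have mem_centralizer {w : unitary B} (hcw : Commute c w) :
      (w : B) ∈ StarSubalgebra.centralizer ℂ {(c : B)} := by
    rw [StarSubalgebra.mem_centralizer_iff]
    rintro _ rfl
    exact ⟨congrArg Subtype.val hcw.eq, congrArg Subtype.val hcw.inv_left.eq⟩
  refine Semigroup.mem_center_iff.2 fun x ↦ ?_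
  have hx := mem_of_eq_top hgen (Set.isClosed_centralizer _) (mem_centralizer hcu)
    (mem_centralizer hcv) x
  exact ((StarSubalgebra.mem_centralizer_iff ℂ).1 hx c rfl).1.symm

end generatedCStar

section TracialStates

section Algebra

variable {B : Type*} [Ring B] [StarRing B] [Algebra ℂ B]

lemma IsTracialState.nontrivial {τ : B →ₗ[ℂ] ℂ} (hτ : IsTracialState τ) : Nontrivial B :=
  ⟨1, 0, fun h ↦ one_ne_zero (hτ.map_one.symm.trans ((congrArg τ h).trans (map_zero τ)))⟩

/-- The centralizer of a functional `φ`: the elements `a` such that `φ (a * b) = φ (b * a)` and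
`φ (star a * b) = φ (b * star a)` for all `b`. The functional is tracial if and only if its
centralizer is everything. -/
def functionalCentralizer [StarModule ℂ B] (φ : B →ₗ[ℂ] ℂ) : StarSubalgebra ℂ B where
  carrier := {a | ∀ b, φ (a * b) = φ (b * a) ∧ φ (star a * b) = φ (b * star a)}
  mul_mem' {x y} hx hy b := by
    constructor
    · rw [mul_assoc, (hx _).1, mul_assoc, (hy _).1, mul_assoc]
    · rw [star_mul, mul_assoc, (hy _).2, mul_assoc, (hx _).2, mul_assoc]
  add_mem' {x y} hx hy b := by
    simp only [star_add, add_mul, mul_add, map_add, (hx b).1, (hy b).1, (hx b).2, (hy b).2,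
      and_self]
  algebraMap_mem' r b := by
    rw [← algebraMap_star_comm, Algebra.commutes, Algebra.commutes]
    exact ⟨rfl, rfl⟩
  star_mem' {x} hx b := ⟨(hx b).2, by rw [star_star]; exact (hx b).1⟩

end Algebra

variable {B : Type*} [CStarAlgebra B]

lemma isClosed_functionalCentralizer (φ : StrongDual ℂ B) :
    IsClosed (functionalCentralizer (φ : B →ₗ[ℂ] ℂ) : Set B) := by
  have : (functionalCentralizer (φ : B →ₗ[ℂ] ℂ) : Set B) =
    ⋂ b, {a | φ (a * b) = φ (b * a)} ∩ {a | φ (star a * b) = φ (b * star a)} := by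
    ext; simp [functionalCentralizer]
  rw [this]
  exact isClosed_iInter fun b ↦ (isClosed_eq (by fun_prop) (by fun_prop)).inter
    (isClosed_eq (by fun_prop) (by fun_prop))

/-- The weak-* continuous map `φ ↦ φ (u * · * star u)` on functionals. -/
noncomputable def conjDual (u : unitary B) : WeakDual ℂ B →L[ℝ] WeakDual ℂ B where
  toFun φ := StrongDual.toWeakDual <|
    (WeakDual.toStrongDual φ).comp (ContinuousLinearMap.mulLeftRight ℂ B u (star (u : B)))
  map_add' _ _ := rfl
  map_smul' _ _ := rfl
  cont := WeakDual.continuous_of_continuous_eval fun x ↦ WeakDual.eval_continuous (u * x * star u)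

lemma mapsTo_conjDual_stateSpace (u : unitary B) :
    Set.MapsTo (conjDual u) (stateSpace B) (stateSpace B) := fun φ hφ ↦ by
  refine ⟨?_, ?_⟩
  · refine mem_closedBall_zero_iff.2 (ContinuousLinearMap.opNorm_le_bound _ zero_le_one fun x ↦ ?_)
    change ‖φ (u * x * star (u : B))‖ ≤ 1 * ‖x‖
    rw [one_mul]
    refine (stateSpace.norm_apply_le hφ _).trans_eq ?_
    rw [← Unitary.coe_star, CStarRing.norm_mul_coe_unitary, CStarRing.norm_coe_unitary_mul]
  · change φ (u * 1 * star (u : B)) = 1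
    rw [mul_one, Unitary.mul_star_self_of_mem u.2, stateSpace.map_one hφ]

lemma commute_conjDual {u v : unitary B} (hc : (↑⁅u, v⁆ : B) ∈ Set.center B) :
    Commute (conjDual u) (conjDual v) := by
  have conj_eq (x : B) : u * (v * x * star (v : B)) * star (u : B) =
      v * (u * x * star (u : B)) * star (v : B) := by
    have huv : (u * v : B) = (↑⁅u, v⁆ : B) * (v * u) := by
      exact_mod_cast congrArg Subtype.val (show u * v = ⁅u, v⁆ * (v * u) by group)
    calc u * (v * x * star (v : B)) * star (u : B)
        = (u * v) * x * star (u * v : B) := by simp only [star_mul, mul_assoc]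
      _ = (↑⁅u, v⁆ : B) * (v * u * x * star (v * u : B)) * star (↑⁅u, v⁆ : B) := by
        rw [huv]; simp only [star_mul, mul_assoc]
      _ = v * u * x * star (v * u : B) := by
        rw [(hc.comm _).eq, mul_assoc, Unitary.mul_star_self_of_mem ⁅u, v⁆.2, mul_one]
      _ = v * (u * x * star (u : B)) * star (v : B) := by simp only [star_mul, mul_assoc]
  refine ContinuousLinearMap.ext fun φ ↦ DFunLike.ext _ _ fun x ↦ ?_
  exact congrArg φ (conj_eq x).symm

lemma mem_functionalCentralizer_of_conjDual_eq {u : unitary B} {φ : WeakDual ℂ B}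
    (hφ : conjDual u φ = φ) :
    (u : B) ∈ functionalCentralizer (WeakDual.toStrongDual φ : B →ₗ[ℂ] ℂ) := fun b ↦ by
  have conj (x : B) : φ (u * x * star (u : B)) = φ x := DFunLike.congr_fun hφ x
  constructor
  · have h := conj (b * u)
    rwa [← mul_assoc, mul_assoc _ (u : B), Unitary.mul_star_self_of_mem u.2, mul_one] at h
  · have h := conj (star (u : B) * b)
    rw [← mul_assoc, Unitary.mul_star_self_of_mem u.2, one_mul] at h
    exact h.symm

theorem exists_isTracialState_apply_eq {u v : unitary B} (hgen : generatedCStar (u : B) v = ⊤)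
    (huv : (↑⁅u, v⁆ : B) ∈ Set.center B) {c : B} [IsStarNormal c] (hc : c ∈ Set.center B) {μ : ℂ}
    (hμ : μ ∈ spectrum ℂ c) : ∃ τ : B →ₗ[ℂ] ℂ, IsTracialState τ ∧ τ c = μ := by
  let K : Set (WeakDual ℂ B) := stateSpace B ∩ {φ | φ c = μ}
  have K_compact : IsCompact K := isCompact_stateSpace.inter_right
    (isClosed_eq (WeakDual.eval_continuous c) continuous_const)
  have K_convex : Convex ℝ K := convex_stateSpace.inter fun φ hφ ψ hψ a b _ _ hab ↦ by
    change a • φ c + b • ψ c = μ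
    rw [show φ c = μ from hφ, show ψ c = μ from hψ, ← add_smul, hab, one_smul]
  have mapsTo (w : unitary B) : Set.MapsTo (conjDual w) K K := fun φ ⟨hφ, hφc⟩ ↦
    ⟨mapsTo_conjDual_stateSpace w hφ, by
      change φ (w * c * star (w : B)) = μ
      rwa [← (hc.comm _).eq, mul_assoc, Unitary.mul_star_self_of_mem w.2, mul_one]⟩
  obtain ⟨φ, ⟨hφ, hφc⟩, hφu, hφv⟩ := exists_map_eq_self_of_commute (commute_conjDual huv)
    K_compact K_convex (exists_mem_stateSpace_apply_eq hμ) (mapsTo u) (mapsTo v)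
  refine ⟨WeakDual.toStrongDual φ, ⟨stateSpace.apply_star_mul_self_nonneg hφ,
    stateSpace.map_one hφ, fun a b ↦ ?_⟩, hφc⟩
  exact (generatedCStar.mem_of_eq_top hgen (isClosed_functionalCentralizer _)
    (mem_functionalCentralizer_of_conjDual_eq hφu)
    (mem_functionalCentralizer_of_conjDual_eq hφv) a b).1

theorem exists_eq_algebraMap_of_mem_center {u v : unitary B}
    (hgen : generatedCStar (u : B) v = ⊤) (huv : (↑⁅u, v⁆ : B) ∈ Set.center B)
    (hτ : ∃! τ : B →ₗ[ℂ] ℂ, IsTracialState τ) {c : B} [IsStarNormal c] (hc : c ∈ Set.center B) :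
    ∃ μ : ℂ, c = algebraMap ℂ B μ := by
  obtain ⟨τ, -, unique⟩ := hτ
  refine ⟨τ c, CFC.eq_algebraMap_of_spectrum_subset_singleton c _ fun μ hμ ↦ ?_⟩
  obtain ⟨τ', hτ', rfl⟩ := exists_isTracialState_apply_eq hgen huv hc hμ
  rw [unique τ' hτ']
  rfl

theorem exists_eq_smul_one_of_mem_center {u v : unitary B}
    (hgen : generatedCStar (u : B) v = ⊤) (huv : (↑⁅u, v⁆ : B) ∈ Set.center B)
    (hτ : ∃! τ : B →ₗ[ℂ] ℂ, IsTracialState τ) (w : unitary B) (hw : (w : B) ∈ Set.center B) :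
    ∃ μ : unitary ℂ, w = μ • (1 : unitary B) := by
  have := hτ.exists.choose_spec.nontrivial
  obtain ⟨μ, hμ⟩ := exists_eq_algebraMap_of_mem_center hgen huv hτ hw
  have μ_mem : μ ∈ unitary ℂ := by
    refine Unitary.mem_iff_star_mul_self.2 (FaithfulSMul.algebraMap_injective ℂ B ?_)
    rw [map_mul, map_one, algebraMap_star_comm, ← hμ, Unitary.star_mul_self_of_mem w.2]
  exact ⟨⟨μ, μ_mem⟩, Subtype.ext (hμ.trans (Algebra.algebraMap_eq_smul_one μ))⟩

end TracialStates

lemma generatedCStar.surjective_of_mem_range {R B : Type*} [Semiring R] [StarRing R] [Algebra ℂ R]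
    [CStarAlgebra B] {u v : B} (hgen : generatedCStar u v = ⊤) (φ : R →⋆ₐ[ℂ] B)
    (hφ : IsClosed (Set.range φ)) (hu : u ∈ Set.range φ) (hv : v ∈ Set.range φ) :
    Function.Surjective φ :=
  generatedCStar.mem_of_eq_top hgen (S := φ.range) hφ hu hv

section MatrixUnits

variable {ι R B : Type*} [Fintype ι] [DecidableEq ι] [CommSemiring R] [StarRing R] [Semiring B]
  [StarRing B] [Algebra R B]

/-- A self-adjoint system of matrix units in a ⋆-ring. -/
structure IsMatrixUnits (e : ι → ι → B) : Prop where
  mul (i j k l : ι) : e i j * e k l = if j = k then e i l else 0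
  sum_diag : ∑ i, e i i = 1
  star (i j : ι) : star (e i j) = e j i

namespace IsMatrixUnits

variable {e : ι → ι → B} (he : IsMatrixUnits e)

include he

/-- The ⋆-homomorphism `a ↦ ∑ i j, a i j • e i j` out of the matrix algebra determined by a system
of matrix units `e`. -/
def starAlgHom [StarModule R B] : Matrix ι ι R →⋆ₐ[R] B where
  toFun a := ∑ i, ∑ j, a i j • e i j
  map_one' := by simp [Matrix.one_apply, ite_smul, he.sum_diag]
  map_mul' a b := by
    simp only [Matrix.mul_apply, Finset.sum_mul, Finset.mul_sum, smul_mul_smul_comm, he.mul,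
      smul_ite, smul_zero, Finset.sum_smul, Finset.sum_ite_eq', Finset.mem_univ, if_true]
    exact Finset.sum_comm_cycle.trans <| Finset.sum_congr rfl fun _ _ ↦ Finset.sum_comm
  map_zero' := by simp
  map_add' a b := by simp [add_smul, Finset.sum_add_distrib]
  commutes' r := by
    simp [Matrix.algebraMap_matrix_apply, ite_smul, ← Finset.smul_sum, he.sum_diag,
      Algebra.algebraMap_eq_smul_one]
  map_star' a := by
    simp only [star_sum, star_smul, he.star, Matrix.star_apply]
    exact Finset.sum_comm

lemma starAlgHom_single [StarModule R B] (i j : ι) :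
    he.starAlgHom (Matrix.single i j (1 : R)) = e i j := by
  change ∑ k, ∑ l, Matrix.single i j (1 : R) k l • e k l = e i j
  simp [Matrix.single_apply, ite_smul, ite_and]

end IsMatrixUnits

end MatrixUnits

section ScalarCommutation

variable {M G : Type*} [CommGroup M] [Group G] [MulAction M G] [IsScalarTower M G G]
  [SMulCommClass M G G]

lemma zpow_mul_zpow_of_mul_eq_smul {ω : M} {u v : G} (h : u * v = ω • (v * u)) (j k : ℤ) :
    u ^ j * v ^ k = ω ^ (j * k) • (v ^ k * u ^ j) := by
  have h₁ : SemiconjBy v u (ω⁻¹ • u) := by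
    rw [SemiconjBy, smul_mul_assoc, h, inv_smul_smul]
  have h₂ : SemiconjBy (u ^ j) v (ω ^ j • v) := by
    have := h₁.zpow_right j
    rw [smul_zpow, inv_zpow, SemiconjBy, smul_mul_assoc, eq_inv_smul_iff] at this
    rw [SemiconjBy, smul_mul_assoc, this]
  have h₃ := (h₂.zpow_right k).eq
  rwa [smul_zpow, ← zpow_mul, smul_mul_assoc] at h₃

end ScalarCommutation

lemma inv_mul_geom_sum_of_pow_eq_one {K : Type*} [Field K] [CharZero K] [DecidableEq K]
    {n : ℕ} (hn : n ≠ 0) {ζ : K} (hζ : ζ ^ n = 1) :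
    (n : K)⁻¹ * ∑ k ∈ Finset.range n, ζ ^ k = if ζ = 1 then 1 else 0 := by
  split_ifs with h
  · simp [h, hn]
  · rw [geom_sum_eq h, hζ, sub_self, zero_div, mul_zero]

section ScalarCommutator

instance {R A : Type*} [Monoid R] [StarMul R] [Monoid A] [StarMul A] [MulAction R A]
    [SMulCommClass R A A] [IsScalarTower R A A] [StarModule R A] :
    IsScalarTower (unitary R) (unitary A) (unitary A) :=
  ⟨fun r a b ↦ Subtype.ext (smul_mul_assoc (r : R) (a : A) b)⟩

instance {R A : Type*} [Monoid R] [StarMul R] [Monoid A] [StarMul A] [MulAction R A]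
    [SMulCommClass R A A] [IsScalarTower R A A] [StarModule R A] :
    SMulCommClass (unitary R) (unitary A) (unitary A) :=
  ⟨fun r a b ↦ Subtype.ext (mul_smul_comm (r : R) (a : A) b).symm⟩

variable {B : Type*} [CStarAlgebra B]

theorem exists_mul_eq_smul_mul {u v : unitary B} (hgen : generatedCStar (u : B) v = ⊤)
    (hu : Commute ⁅u, v⁆ u) (hv : Commute ⁅u, v⁆ v)
    (hτ : ∃! τ : B →ₗ[ℂ] ℂ, IsTracialState τ) : ∃ ω : unitary ℂ, u * v = ω • (v * u) := by
  have hc := generatedCStar.mem_center_of_commute hgen hu hv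
  obtain ⟨μ, hμ⟩ := exists_eq_smul_one_of_mem_center hgen hc hτ ⁅u, v⁆ hc
  refine ⟨μ, ?_⟩
  rw [← smul_one_mul, ← hμ]
  group

end ScalarCommutator

section SpectralProjection

section Algebra

variable {B : Type*} [Ring B] [Algebra ℂ B]

/-- The spectral projection of an element `x` with `x ^ n = 1` at the eigenvalue `1`, as an average
of powers of `x`. -/
noncomputable def spectralProj (n : ℕ) (x : B) : B := (n : ℂ)⁻¹ • ∑ k ∈ Finset.range n, x ^ k

lemma spectralProj_mul_of_mul_eq_smul {n : ℕ} (hn : n ≠ 0) {x y : B} {ζ : ℂ}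
    (h : x * y = ζ • y) (hζ : ζ ^ n = 1) :
    spectralProj n x * y = if ζ = 1 then y else 0 := by
  have pow_mul (k : ℕ) : x ^ k * y = ζ ^ k • y := by
    induction k with
    | zero => simp
    | succ k ih => rw [pow_succ, mul_assoc, h, mul_smul_comm, ih, smul_smul, pow_succ']
  rw [spectralProj, smul_mul_assoc, Finset.sum_mul, Finset.sum_congr rfl fun k _ ↦ pow_mul k,
    ← Finset.sum_smul, smul_smul, inv_mul_geom_sum_of_pow_eq_one hn hζ, ite_smul, one_smul,
    zero_smul]

lemma mul_spectralProj {n : ℕ} {x : B} (hx : x ^ n = 1) :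
    x * spectralProj n x = spectralProj n x := by
  have : (x - 1) * spectralProj n x = 0 := by
    rw [spectralProj, mul_smul_comm, mul_geom_sum, hx, sub_self, smul_zero]
  rwa [sub_mul, one_mul, sub_eq_zero] at this

end Algebra

variable {B : Type*} [Ring B] [StarRing B] [Algebra ℂ B] [StarModule ℂ B] {n : ℕ}
  {u v : unitary B} {ω : unitary ℂ}

lemma isSelfAdjoint_spectralProj (hn : n ≠ 0) (hu : (u : B) ^ n = 1) :
    IsSelfAdjoint (spectralProj n (u : B)) := by
  have star_mul : star (u : B) * spectralProj n (u : B) = (1 : ℂ) • spectralProj n (u : B) := by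
    nth_rw 1 [← mul_spectralProj hu]
    rw [← mul_assoc, Unitary.star_mul_self_of_mem u.2, one_mul, one_smul]
  have star_mul_self : star (spectralProj n (u : B)) * spectralProj n (u : B) =
      spectralProj n (u : B) := by
    have : star (spectralProj n (u : B)) = spectralProj n (star (u : B)) := by
      simp [spectralProj, star_sum]
    rw [this, spectralProj_mul_of_mul_eq_smul hn star_mul (one_pow n), if_pos rfl]
  rw [← star_mul_self]
  exact IsSelfAdjoint.star_mul_self _

lemma spectralProj_mul_mul_spectralProj (hn : n ≠ 0) (hu : (u : B) ^ n = 1)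
    (huv : u * v = ω • (v * u)) (hω : ω ^ n = 1) :
    spectralProj n (u : B) * v * spectralProj n (u : B) =
      if ω = 1 then v * spectralProj n (u : B) else 0 := by
  have huv' : (u : B) * v = (ω : ℂ) • (v * u : B) := congrArg Subtype.val huv
  have hω' : (ω : ℂ) ^ n = 1 := by
    rwa [← SubmonoidClass.coe_pow, OneMemClass.coe_eq_one]
  rw [mul_assoc, spectralProj_mul_of_mul_eq_smul hn _ hω']
  · simp only [OneMemClass.coe_eq_one]
  · rw [← mul_assoc, huv', smul_mul_assoc, mul_assoc, mul_spectralProj hu]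

lemma sum_conj_spectralProj (huv : u * v = ω • (v * u)) (hω : orderOf ω ≠ 0) :
    ∑ i ∈ Finset.range (orderOf ω), (↑(v ^ (i : ℤ)) : B) * spectralProj (orderOf ω) (u : B) *
      (↑(v ^ (-i : ℤ)) : B) = 1 := by
  set n := orderOf ω
  have conj_pow (i k : ℕ) : (↑(v ^ (i : ℤ)) : B) * (u : B) ^ k * (↑(v ^ (-i : ℤ)) : B) =
      (↑(ω ^ k)⁻¹ : ℂ) ^ i • (u : B) ^ k := by
    have h : v ^ (i : ℤ) * u ^ k * v ^ (-i : ℤ) = ((ω ^ k)⁻¹) ^ i • u ^ k := by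
      have := zpow_mul_zpow_of_mul_eq_smul (M := unitary ℂ) (G := unitary B) huv k i
      simp only [zpow_mul, zpow_natCast] at this
      rw [zpow_neg, mul_inv_eq_iff_eq_mul, smul_mul_assoc, inv_pow, eq_inv_smul_iff, zpow_natCast,
        ← this]
    rw [← SubmonoidClass.coe_pow, ← SubmonoidClass.coe_pow]
    exact congrArg Subtype.val h
  have pow_eq_one (k : ℕ) : (↑(ω ^ k)⁻¹ : ℂ) ^ n = 1 := by
    rw [← SubmonoidClass.coe_pow, OneMemClass.coe_eq_one, inv_pow, pow_right_comm,
      pow_orderOf_eq_one, one_pow, inv_one]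
  calc _ = ∑ k ∈ Finset.range n, ((n : ℂ)⁻¹ * ∑ i ∈ Finset.range n, (↑(ω ^ k)⁻¹ : ℂ) ^ i) •
        (u : B) ^ k := by
        simp only [spectralProj, mul_smul_comm, smul_mul_assoc, Finset.mul_sum, Finset.sum_mul,
          conj_pow, ← Finset.smul_sum, mul_smul, Finset.sum_smul]
        rw [Finset.sum_comm]
    _ = ∑ k ∈ Finset.range n, if k = 0 then (u : B) ^ k else 0 := by
        refine Finset.sum_congr rfl fun k hk ↦ ?_
        rw [inv_mul_geom_sum_of_pow_eq_one hω (pow_eq_one k), ite_smul, one_smul, zero_smul]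
        congr 1
        rw [OneMemClass.coe_eq_one, inv_eq_one, ← orderOf_dvd_iff_pow_eq_one, eq_iff_iff]
        exact ⟨(Nat.eq_zero_of_dvd_of_lt · (Finset.mem_range.1 hk)), (· ▸ dvd_zero _)⟩
    _ = 1 := by simp [Nat.pos_of_ne_zero hω]

end SpectralProjection

section FiniteOrder

variable {B : Type*} [Ring B] [StarRing B] [Algebra ℂ B] {u v : unitary B}

/-- The matrix units `v ^ i * p * v ^ (-j)` attached to unitaries `u`, `v` satisfying
`u * v = ω • (v * u)` and `u ^ n = 1`, where `n` is the order of `ω` and `p` is the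
eigenprojection of `u` at `1`. -/
noncomputable def weylMatrixUnit (n : ℕ) (u v : unitary B) (i j : Fin n) : B :=
  ↑(v ^ ((i : ℕ) : ℤ)) * spectralProj n (u : B) * ↑(v ^ (-(j : ℕ) : ℤ))

lemma coe_mul_weylMatrixUnit_right {n : ℕ} [NeZero n] (hv : v ^ n = 1) (i j : Fin n) :
    (v : B) * weylMatrixUnit n u v i j = weylMatrixUnit n u v (i + 1) j := by
  have : v * v ^ ((i : ℕ) : ℤ) = v ^ (((i + 1 : Fin n) : ℕ) : ℤ) := by
    rw [zpow_natCast, zpow_natCast, ← pow_succ', Fin.val_add, Fin.val_one', Nat.add_mod_mod,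
      pow_eq_pow_mod _ hv]
  rw [weylMatrixUnit, weylMatrixUnit, ← this, Submonoid.coe_mul]
  simp only [mul_assoc]

variable [StarModule ℂ B] {ω : unitary ℂ}

theorem isMatrixUnits_weylMatrixUnit (huv : u * v = ω • (v * u)) (hω : orderOf ω ≠ 0)
    (hu : (u : B) ^ orderOf ω = 1) : IsMatrixUnits (weylMatrixUnit (orderOf ω) u v) where
  mul i j k l := by
    have comm : u * v ^ ((k : ℤ) - (j : ℤ)) =
        ω ^ ((k : ℤ) - (j : ℤ)) • (v ^ ((k : ℤ) - (j : ℤ)) * u) := by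
      simpa using zpow_mul_zpow_of_mul_eq_smul (M := unitary ℂ) (G := unitary B) huv 1 (k - j)
    have zpow_sub_pow : (ω ^ ((k : ℤ) - (j : ℤ))) ^ orderOf ω = 1 := by
      rw [← zpow_natCast, zpow_comm, zpow_natCast, pow_orderOf_eq_one, one_zpow]
    have zpow_sub_eq_one : ω ^ ((k : ℤ) - (j : ℤ)) = 1 ↔ j = k := by
      rw [zpow_sub, mul_inv_eq_one, zpow_natCast, zpow_natCast, eq_comm,
        pow_injOn_Iio_orderOf.eq_iff j.2 k.2, Fin.val_inj]
    have h := spectralProj_mul_mul_spectralProj hω hu comm zpow_sub_pow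
    simp only [zpow_sub_eq_one] at h
    calc _ = ↑(v ^ (i : ℤ)) * (spectralProj (orderOf ω) (u : B) * ↑(v ^ ((k : ℤ) - (j : ℤ))) *
          spectralProj (orderOf ω) (u : B)) * ↑(v ^ (-(l : ℕ) : ℤ)) := by
          rw [sub_eq_neg_add, zpow_add]
          simp only [weylMatrixUnit, Submonoid.coe_mul, mul_assoc]
      _ = _ := by
        rw [h]
        split_ifs with hjk
        · simp [weylMatrixUnit, hjk, mul_assoc]
        · simp
  sum_diag := by
    rw [← sum_conj_spectralProj huv hω, ← Fin.sum_univ_eq_sum_range (fun i ↦ ↑(v ^ (i : ℤ)) *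
      spectralProj (orderOf ω) (u : B) * ↑(v ^ (-i : ℤ)))]
    rfl
  star i j := by
    simp only [weylMatrixUnit, star_mul, (isSelfAdjoint_spectralProj hω hu).star_eq,
      ← Unitary.coe_star, Unitary.star_eq_inv, zpow_neg, inv_inv, mul_assoc]

lemma coe_mul_weylMatrixUnit_left {n : ℕ} (huv : u * v = ω • (v * u)) (hu : (u : B) ^ n = 1)
    (i j : Fin n) :
    (u : B) * weylMatrixUnit n u v i j = (ω : ℂ) ^ (i : ℕ) • weylMatrixUnit n u v i j := by
  have comm : (u : B) * ↑(v ^ ((i : ℕ) : ℤ)) =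
      (ω : ℂ) ^ (i : ℕ) • (↑(v ^ ((i : ℕ) : ℤ)) * (u : B)) := by
    have := zpow_mul_zpow_of_mul_eq_smul (M := unitary ℂ) (G := unitary B) huv 1 i
    rw [zpow_one, one_mul, zpow_natCast ω] at this
    rw [← SubmonoidClass.coe_pow]
    exact congrArg Subtype.val this
  simp only [weylMatrixUnit, ← mul_assoc, comm, smul_mul_assoc]
  rw [mul_assoc _ (u : B), mul_spectralProj hu]

end FiniteOrder

section ScalarNormalization

variable {B : Type*} [Ring B] [StarRing B] [Algebra ℂ B] [StarModule ℂ B]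
  {u v : unitary B} {ω : unitary ℂ}

lemma exists_smul_pow_eq_one {w : unitary B} {n : ℕ} (hn : n ≠ 0) {μ : unitary ℂ}
    (h : w ^ n = μ • (1 : unitary B)) : ∃ a : unitary ℂ, (a • w) ^ n = 1 := by
  obtain ⟨a, ha⟩ := IsAlgClosed.exists_pow_nat_eq (↑μ⁻¹ : ℂ) (Nat.pos_of_ne_zero hn)
  have norm_a : ‖a‖ = 1 := by
    rw [← pow_eq_one_iff_of_nonneg (norm_nonneg a) hn, ← norm_pow, ha, CStarRing.norm_coe_unitary]
  have a_mem : a ∈ unitary ℂ := by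
    rw [Unitary.mem_iff_star_mul_self]
    simp [Complex.conj_mul', norm_a]
  refine ⟨⟨a, a_mem⟩, ?_⟩
  have : (⟨a, a_mem⟩ : unitary ℂ) ^ n = μ⁻¹ := Subtype.ext ha
  rw [smul_pow, h, this, inv_smul_smul]

lemma smul_mul_smul_eq_smul (huv : u * v = ω • (v * u)) (a b : unitary ℂ) :
    (a • u) * (b • v) = ω • ((b • v) * (a • u)) := by
  rw [smul_mul_smul_comm, huv, smul_mul_smul_comm, smul_comm, mul_comm a b]

lemma commutatorElement_mem_center (huv : u * v = ω • (v * u)) :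
    (↑⁅u, v⁆ : B) ∈ Set.center B := by
  have : (↑⁅u, v⁆ : B) = algebraMap ℂ B ω := by
    rw [commutatorElement_def, huv, smul_mul_assoc, smul_mul_assoc, mul_inv_cancel_right,
      mul_inv_cancel, Algebra.algebraMap_eq_smul_one, Unitary.coe_smul]
    rfl
  exact this ▸ Semigroup.mem_center_iff.2 fun x ↦ (Algebra.commutes _ x).symm

end ScalarNormalization

section MatrixAlgebra

variable {B : Type*} [CStarAlgebra B] {u v : unitary B} {ω : unitary ℂ}

theorem nonempty_starAlgEquiv_matrix_of_pow_eq_one [Nontrivial B]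
    (hgen : generatedCStar (u : B) v = ⊤) (huv : u * v = ω • (v * u)) (hω : orderOf ω ≠ 0)
    (hu : u ^ orderOf ω = 1) (hv : v ^ orderOf ω = 1) :
    Nonempty (B ≃⋆ₐ[ℂ] Matrix (Fin (orderOf ω)) (Fin (orderOf ω)) ℂ) := by
  have : NeZero (orderOf ω) := ⟨hω⟩
  have hu' : (u : B) ^ orderOf ω = 1 := by rwa [← SubmonoidClass.coe_pow, OneMemClass.coe_eq_one]
  let e := weylMatrixUnit (orderOf ω) u v
  have he : IsMatrixUnits e := isMatrixUnits_weylMatrixUnit huv hω hu'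
  let φ : Matrix (Fin (orderOf ω)) (Fin (orderOf ω)) ℂ →⋆ₐ[ℂ] B := he.starAlgHom
  have e_mem (i j : Fin (orderOf ω)) : e i j ∈ φ.range := ⟨_, he.starAlgHom_single i j⟩
  have u_mem : (u : B) ∈ φ.range := by
    rw [← mul_one (u : B), ← he.sum_diag, Finset.mul_sum]
    refine sum_mem fun i _ ↦ ?_
    rw [coe_mul_weylMatrixUnit_left huv hu']
    exact φ.range.smul_mem (e_mem i i) _
  have v_mem : (v : B) ∈ φ.range := by
    rw [← mul_one (v : B), ← he.sum_diag, Finset.mul_sum]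
    refine sum_mem fun i _ ↦ ?_
    rw [coe_mul_weylMatrixUnit_right hv]
    exact e_mem (i + 1) i
  have isClosed_range : IsClosed (Set.range φ) :=
    (LinearMap.range φ.toAlgHom.toLinearMap).closed_of_finiteDimensional
  exact ⟨(StarAlgEquiv.ofBijective φ ⟨φ.toAlgHom.toRingHom.injective,
    generatedCStar.surjective_of_mem_range hgen φ isClosed_range u_mem v_mem⟩).symm⟩

theorem nonempty_starAlgEquiv_matrix (hgen : generatedCStar (u : B) v = ⊤)
    (huv : u * v = ω • (v * u)) (hω : orderOf ω ≠ 0)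
    (hτ : ∃! τ : B →ₗ[ℂ] ℂ, IsTracialState τ) :
    Nonempty (B ≃⋆ₐ[ℂ] Matrix (Fin (orderOf ω)) (Fin (orderOf ω)) ℂ) := by
  have := hτ.exists.choose_spec.nontrivial
  have exists_normalization {w : unitary B} (hwu : Commute (w ^ orderOf ω) u)
      (hwv : Commute (w ^ orderOf ω) v) : ∃ a : unitary ℂ, (a • w) ^ orderOf ω = 1 := by
    obtain ⟨μ, hμ⟩ := exists_eq_smul_one_of_mem_center hgen (commutatorElement_mem_center huv) hτ
      (w ^ orderOf ω) (generatedCStar.mem_center_of_commute hgen hwu hwv)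
    exact exists_smul_pow_eq_one hω hμ
  obtain ⟨a, ha⟩ := exists_normalization (w := u) (.pow_self u _) <| by
    simpa [commute_iff_eq, pow_orderOf_eq_one] using zpow_mul_zpow_of_mul_eq_smul
      (M := unitary ℂ) (G := unitary B) huv (orderOf ω) 1
  obtain ⟨b, hb⟩ := exists_normalization (w := v) (Commute.symm <| by
    simpa [commute_iff_eq, pow_orderOf_eq_one] using zpow_mul_zpow_of_mul_eq_smul
      (M := unitary ℂ) (G := unitary B) huv 1 (orderOf ω)) (.pow_self v _)
  have hgen' : generatedCStar (↑(a • u) : B) ↑(b • v) = ⊤ :=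
    top_le_iff.1 <| hgen ▸ generatedCStar.le_smul_smul (Unitary.toUnits a).ne_zero
      (Unitary.toUnits b).ne_zero
  exact nonempty_starAlgEquiv_matrix_of_pow_eq_one hgen' (smul_mul_smul_eq_smul huv a b) hω ha hb

end MatrixAlgebra

section WeylMonomials

variable {M G : Type*} [CommGroup M] [Group G] [MulAction M G]

/-- The monomial `u ^ j * v ^ k` with exponent pair `(j, k)`. -/
def weylMonomial (u v : G) (p : ℤ × ℤ) : G := u ^ p.1 * v ^ p.2

lemma weylMonomial_zero (u v : G) : weylMonomial u v 0 = 1 := by simp [weylMonomial]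

lemma map_weylMonomial {H F : Type*} [Group H] [FunLike F G H] [MonoidHomClass F G H] (f : F)
    (u v : G) (p : ℤ × ℤ) : f (weylMonomial u v p) = weylMonomial (f u) (f v) p := by
  simp only [weylMonomial, map_mul, map_zpow]

variable [IsScalarTower M G G] [SMulCommClass M G G] {ω : M} {u v : G}
  (huv : u * v = ω • (v * u))

include huv

lemma weylMonomial_mul (p q : ℤ × ℤ) :
    weylMonomial u v p * weylMonomial u v q = ω ^ (-(q.1 * p.2)) • weylMonomial u v (p + q) := by
  have swap : v ^ p.2 * u ^ q.1 = ω ^ (-(q.1 * p.2)) • (u ^ q.1 * v ^ p.2) := by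
    rw [zpow_neg, eq_inv_smul_iff, zpow_mul_zpow_of_mul_eq_smul huv]
  calc u ^ p.1 * v ^ p.2 * (u ^ q.1 * v ^ q.2)
      = u ^ p.1 * (v ^ p.2 * u ^ q.1) * v ^ q.2 := by group
    _ = ω ^ (-(q.1 * p.2)) • (u ^ p.1 * (u ^ q.1 * v ^ p.2) * v ^ q.2) := by
      rw [swap, mul_smul_comm, smul_mul_assoc]
    _ = ω ^ (-(q.1 * p.2)) • (u ^ (p.1 + q.1) * v ^ (p.2 + q.2)) := by group

lemma weylMonomial_inv (p : ℤ × ℤ) :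
    (weylMonomial u v p)⁻¹ = ω ^ (-(p.1 * p.2)) • weylMonomial u v (-p) := by
  refine inv_eq_of_mul_eq_one_right ?_
  rw [mul_smul_comm, weylMonomial_mul huv, smul_smul, ← zpow_add, add_neg_cancel,
    weylMonomial_zero, Prod.fst_neg, neg_mul, neg_neg, neg_add_cancel, zpow_zero, one_smul]

lemma weylMonomial_mul_comm (p q : ℤ × ℤ) : weylMonomial u v p * weylMonomial u v q =
    ω ^ (p.1 * q.2 - q.1 * p.2) • (weylMonomial u v q * weylMonomial u v p) := by
  rw [weylMonomial_mul huv, weylMonomial_mul huv, smul_smul, ← zpow_add, add_comm q p]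
  ring_nf

end WeylMonomials

namespace IsTracialState

section Algebra

variable {B : Type*} [Ring B] [StarRing B] [Algebra ℂ B] {τ : B →ₗ[ℂ] ℂ} (hτ : IsTracialState τ)

include hτ

lemma eq_zero_of_mul_eq_smul_mul {g : unitary B} {x : B} {c : ℂ} (hc : c ≠ 1)
    (h : (g : B) * x = c • (x * g)) : τ x = 0 := by
  have : τ x = c * τ x := calc
    τ x = τ ((g : B) * x * star (g : B)) := by
      rw [hτ.map_mul_comm, ← mul_assoc, Unitary.coe_star_mul_self, one_mul]
    _ = c * τ x := by
      rw [h, smul_mul_assoc, mul_assoc, Unitary.mul_star_self_of_mem g.2, mul_one, map_smul,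
        smul_eq_mul]
  exact eq_zero_of_mul_eq_self_left hc this.symm

variable [StarModule ℂ B] {u v : unitary B} {ω : unitary ℂ} (huv : u * v = ω • (v * u))
  (hω : orderOf ω = 0)

include huv hω

lemma apply_weylMonomial {p : ℤ × ℤ} (hp : p ≠ 0) : τ ↑(weylMonomial u v p) = 0 := by
  let q : ℤ × ℤ := (p.2, -p.1)
  have exponent_ne_zero : q.1 * p.2 - p.1 * q.2 ≠ 0 := by
    intro h
    obtain ⟨h₂, h₁⟩ : p.2 = 0 ∧ p.1 = 0 := mul_self_add_mul_self_eq_zero.1 (by simpa [q] using h)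
    exact hp (Prod.ext h₁ h₂)
  have zpow_ne_one : ω ^ (q.1 * p.2 - p.1 * q.2) ≠ 1 := by
    rwa [Ne, ← orderOf_dvd_iff_zpow_eq_one, hω, Nat.cast_zero, zero_dvd_iff]
  refine hτ.eq_zero_of_mul_eq_smul_mul (g := weylMonomial u v q)
    (fun h ↦ zpow_ne_one (Subtype.ext h)) ?_
  exact congrArg Subtype.val
    (weylMonomial_mul_comm (M := unitary ℂ) (G := unitary B) huv q p)

lemma apply_star_weylMonomial_mul (p q : ℤ × ℤ) :
    τ (star (↑(weylMonomial u v p) : B) * ↑(weylMonomial u v q)) = if p = q then 1 else 0 := by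
  split_ifs with h
  · rw [h, Unitary.coe_star_mul_self, hτ.map_one]
  · rw [← Unitary.coe_star, Unitary.star_eq_inv,
      weylMonomial_inv (M := unitary ℂ) (G := unitary B) huv, ← Submonoid.coe_mul, smul_mul_assoc,
      weylMonomial_mul (M := unitary ℂ) (G := unitary B) huv, Unitary.coe_smul, Unitary.coe_smul,
      Submonoid.smul_def, Submonoid.smul_def, map_smul, map_smul,
      hτ.apply_weylMonomial huv hω (neg_add_eq_zero.not.2 h), smul_zero, smul_zero]

end Algebra

variable {B : Type*} [CStarAlgebra B] {τ : B →ₗ[ℂ] ℂ} (hτ : IsTracialState τ)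

include hτ

lemma re_star_mul_self_le (y : B) : (τ (star y * y)).re ≤ ‖y‖ ^ 2 := by
  let := CStarAlgebra.spectralOrder B
  have := CStarAlgebra.spectralOrderedRing B
  obtain ⟨c, hc⟩ := CStarAlgebra.nonneg_iff_eq_star_mul_self.1 <|
    sub_nonneg.2 (CStarAlgebra.star_mul_le_algebraMap_norm_sq (a := y))
  have apply_algebraMap : τ (algebraMap ℝ B (‖y‖ ^ 2)) = (‖y‖ ^ 2 : ℝ) := by
    rw [Algebra.algebraMap_eq_smul_one, LinearMap.map_smul_of_tower, hτ.map_one,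
      Complex.real_smul, mul_one]
  have := (Complex.le_def.1 (hτ.nonneg c)).1
  rwa [← hc, map_sub, apply_algebraMap, Complex.zero_re, Complex.sub_re, Complex.ofReal_re,
    sub_nonneg] at this

lemma sum_norm_sq_le {ι : Type*} [DecidableEq ι] {e : ι → B}
    (he : ∀ i j, τ (star (e i) * e j) = if i = j then 1 else 0) (s : Finset ι) (a : ι → ℂ) :
    ∑ i ∈ s, ‖a i‖ ^ 2 ≤ ‖∑ i ∈ s, a i • e i‖ ^ 2 := by
  have parseval : τ (star (∑ i ∈ s, a i • e i) * ∑ i ∈ s, a i • e i) =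
      (∑ i ∈ s, ‖a i‖ ^ 2 : ℝ) := by
    simp only [star_sum, star_smul, Finset.sum_mul_sum, smul_mul_smul_comm, map_sum, map_smul, he,
      smul_eq_mul, mul_ite, mul_one, mul_zero, Finset.sum_ite_eq, Complex.ofReal_sum]
    refine Finset.sum_congr rfl fun i hi ↦ ?_
    rw [if_pos hi, Complex.star_def, Complex.conj_mul', Complex.ofReal_pow]
  simpa only [parseval, Complex.ofReal_re] using hτ.re_star_mul_self_le (∑ i ∈ s, a i • e i)

lemma norm_sum_smul_sq_le {R : Type*} [CStarAlgebra R] (π : R →⋆ₐ[ℂ] B) {ι : Type*}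
    [DecidableEq ι] {e : ι → R} (norm_le : ∀ i, ‖e i‖ ≤ 1)
    (he : ∀ i j, τ (star (π (e i)) * π (e j)) = if i = j then 1 else 0) (s : Finset ι)
    (a : ι → ℂ) : ‖∑ i ∈ s, a i • e i‖ ^ 2 ≤ s.card * ‖π (∑ i ∈ s, a i • e i)‖ ^ 2 := calc
  ‖∑ i ∈ s, a i • e i‖ ^ 2 ≤ (∑ i ∈ s, ‖a i‖) ^ 2 := by
    gcongr
    refine norm_sum_le_of_le s fun i _ ↦ ?_
    rw [norm_smul]
    exact mul_le_of_le_one_right (norm_nonneg _) (norm_le i)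
  _ ≤ s.card * ∑ i ∈ s, ‖a i‖ ^ 2 := sq_sum_le_card_mul_sum_sq
  _ ≤ s.card * ‖π (∑ i ∈ s, a i • e i)‖ ^ 2 := by
    gcongr
    simpa only [map_sum, map_smul] using hτ.sum_norm_sq_le he s a

end IsTracialState

/-- The square of exponent pairs `(j, k)` with `|j|, |k| ≤ D`. -/
noncomputable def exponentBox (D : ℕ) : Finset (ℤ × ℤ) := Finset.Icc (-D, -D) (D, D)

lemma mem_exponentBox {D : ℕ} {p : ℤ × ℤ} :
    p ∈ exponentBox D ↔ (-D ≤ p.1 ∧ -D ≤ p.2) ∧ p.1 ≤ D ∧ p.2 ≤ D := by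
  rw [exponentBox, Finset.mem_Icc, Prod.le_def, Prod.le_def]

lemma card_exponentBox (D : ℕ) : (exponentBox D).card = (2 * D + 1) ^ 2 := by
  rw [exponentBox, Finset.card_Icc_prod, Int.card_Icc, sq]
  congr 1 <;> omega

/-- The Laurent polynomials in `u` and `v` of degree at most `D` in each variable. -/
noncomputable def laurentSpan {B : Type*} [Ring B] [StarRing B] [Algebra ℂ B] (u v : unitary B)
    (D : ℕ) : Submodule ℂ B :=
  Submodule.span ℂ ((fun p ↦ ↑(weylMonomial u v p)) '' exponentBox D)

namespace laurentSpan

variable {B : Type*} [Ring B] [StarRing B] [Algebra ℂ B] {u v : unitary B} {D E : ℕ} {x y : B}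

lemma weylMonomial_mem {p : ℤ × ℤ} (hp : p ∈ exponentBox D) :
    ↑(weylMonomial u v p) ∈ laurentSpan u v D :=
  Submodule.subset_span ⟨p, hp, rfl⟩

lemma algebraMap_mem (c : ℂ) : algebraMap ℂ B c ∈ laurentSpan u v 0 := by
  have := weylMonomial_mem (u := u) (v := v) (D := 0) (p := 0) (by simp [mem_exponentBox])
  rw [weylMonomial_zero] at this
  rw [Algebra.algebraMap_eq_smul_one]
  exact Submodule.smul_mem _ c this

lemma mono (h : D ≤ E) : laurentSpan u v D ≤ laurentSpan u v E := by
  refine Submodule.span_mono (Set.image_mono fun p hp ↦ ?_)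
  rw [Finset.mem_coe, mem_exponentBox] at hp ⊢
  omega

variable [StarModule ℂ B] {ω : unitary ℂ} (huv : u * v = ω • (v * u))

include huv

lemma mul_mem (hx : x ∈ laurentSpan u v D) (hy : y ∈ laurentSpan u v E) :
    x * y ∈ laurentSpan u v (D + E) := by
  have hxy := Submodule.mul_mem_mul hx hy
  rw [laurentSpan, laurentSpan, Submodule.span_mul_span] at hxy
  refine Submodule.span_le.2 ?_ hxy
  rintro _ ⟨_, ⟨p, hp, rfl⟩, _, ⟨q, hq, rfl⟩, rfl⟩
  have hpq : p + q ∈ exponentBox (D + E) := by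
    rw [Finset.mem_coe, mem_exponentBox] at hp hq
    rw [mem_exponentBox, Prod.fst_add, Prod.snd_add]
    omega
  simp only [← Submonoid.coe_mul, weylMonomial_mul (M := unitary ℂ) (G := unitary B) huv]
  exact Submodule.smul_mem _ _ (weylMonomial_mem hpq)

lemma star_mem (hx : x ∈ laurentSpan u v D) : star x ∈ laurentSpan u v D := by
  induction hx using Submodule.span_induction with
  | mem x hx =>
    obtain ⟨p, hp, rfl⟩ := hx
    have hp' : -p ∈ exponentBox D := by
      rw [Finset.mem_coe, mem_exponentBox] at hp
      rw [mem_exponentBox, Prod.fst_neg, Prod.snd_neg]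
      omega
    rw [← Unitary.coe_star, Unitary.star_eq_inv,
      weylMonomial_inv (M := unitary ℂ) (G := unitary B) huv]
    exact Submodule.smul_mem _ _ (weylMonomial_mem hp')
  | zero => rw [star_zero]; exact zero_mem _
  | add x y _ _ hx hy => rw [star_add]; exact add_mem hx hy
  | smul c x _ hx => rw [star_smul]; exact Submodule.smul_mem _ _ hx

lemma pow_mem (hx : x ∈ laurentSpan u v D) (n : ℕ) : x ^ n ∈ laurentSpan u v (D * n) := by
  induction n with
  | zero => simpa only [mul_zero, pow_zero, map_one] using algebraMap_mem (u := u) (v := v) 1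
  | succ n ih => simpa only [mul_add_one, pow_succ] using mul_mem huv ih hx

lemma exists_mem_of_mem_adjoin (hx : x ∈ StarAlgebra.adjoin ℂ {(u : B), (v : B)}) :
    ∃ D, x ∈ laurentSpan u v D := by
  induction hx using StarAlgebra.adjoin_induction with
  | mem x hx =>
    refine ⟨1, ?_⟩
    rcases hx with rfl | rfl
    · simpa [weylMonomial] using
        weylMonomial_mem (u := u) (v := v) (p := (1, 0)) (by simp [mem_exponentBox])
    · simpa [weylMonomial] using
        weylMonomial_mem (u := u) (v := v) (p := (0, 1)) (by simp [mem_exponentBox])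
  | algebraMap c => exact ⟨0, algebraMap_mem c⟩
  | add x y _ _ hx hy =>
    obtain ⟨⟨D, hD⟩, ⟨E, hE⟩⟩ := And.intro hx hy
    exact ⟨max D E, add_mem (mono (le_max_left D E) hD) (mono (le_max_right D E) hE)⟩
  | mul x y _ _ hx hy =>
    obtain ⟨⟨D, hD⟩, ⟨E, hE⟩⟩ := And.intro hx hy
    exact ⟨D + E, mul_mem huv hD hE⟩
  | star x _ hx => exact hx.imp fun D hD ↦ star_mem huv hD

end laurentSpan

lemma le_of_frequently_pow_le_mul_pow {a b C : ℝ} (hb : 0 ≤ b)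
    (h : ∃ᶠ n : ℕ in atTop, a ^ n ≤ (C * n + 1) * b ^ n) : a ≤ b := by
  by_contra! hab
  have ha : 0 < a := hb.trans_lt hab
  have tendsto_zero : Tendsto (fun n : ℕ ↦ (C * n + 1) * (b / a) ^ n) atTop (𝓝 0) := by
    have := ((tendsto_self_mul_const_pow_of_lt_one (div_nonneg hb ha.le)
      ((div_lt_one ha).2 hab)).const_mul C).add
      (tendsto_pow_atTop_nhds_zero_of_lt_one (div_nonneg hb ha.le) ((div_lt_one ha).2 hab))
    simpa only [add_mul, one_mul, mul_assoc, mul_zero, add_zero] using this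
  obtain ⟨n, hn, hlt⟩ := (h.and_eventually (tendsto_zero.eventually_lt_const one_pos)).exists
  rw [div_pow, ← mul_div_assoc, div_lt_one (pow_pos ha n)] at hlt
  exact hlt.not_ge hn

section TracialHomomorphism

variable {R B : Type*} [CStarAlgebra R] [CStarAlgebra B] {U V : unitary R} {ω : unitary ℂ}
  {τ : B →ₗ[ℂ] ℂ} (hτ : IsTracialState τ) (hUV : U * V = ω • (V * U)) (hω : orderOf ω = 0)
  (π : R →⋆ₐ[ℂ] B)

include hτ hUV hω

lemma norm_le_mul_norm_map_of_mem_laurentSpan {D : ℕ} {x : R} (hx : x ∈ laurentSpan U V D) :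
    ‖x‖ ≤ (2 * D + 1) * ‖π x‖ := by
  let f : unitary R →* unitary B := Unitary.map (.ofClass π)
  have huv : f U * f V = ω • (f V * f U) := by
    rw [← map_mul, hUV, ← map_mul]
    exact Subtype.ext (map_smul π (ω : ℂ) _)
  have orthonormal (p q : ℤ × ℤ) :
      τ (star (π ↑(weylMonomial U V p)) * π ↑(weylMonomial U V q)) = if p = q then 1 else 0 := by
    rw [← hτ.apply_star_weylMonomial_mul huv hω, ← map_weylMonomial f, ← map_weylMonomial f]
    rfl
  have norm_le (p : ℤ × ℤ) : ‖(↑(weylMonomial U V p) : R)‖ ≤ 1 := by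
    nontriviality R
    exact (CStarRing.norm_coe_unitary _).le
  obtain ⟨a, rfl⟩ := (Submodule.mem_span_image_finset_iff_exists_fun' ℂ).1 hx
  refine le_of_sq_le_sq ((hτ.norm_sum_smul_sq_le π norm_le orthonormal _ a).trans_eq ?_)
    (by positivity)
  rw [card_exponentBox, mul_pow]
  push_cast
  rfl

lemma norm_le_norm_map_of_mem_laurentSpan {D : ℕ} {x : R} (hx : x ∈ laurentSpan U V D) :
    ‖x‖ ≤ ‖π x‖ := by
  have norm_le_of_isSelfAdjoint {E : ℕ} {y : R} (hy : y ∈ laurentSpan U V E)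
      (hsa : IsSelfAdjoint y) : ‖y‖ ≤ ‖π y‖ := by
    refine le_of_frequently_pow_le_mul_pow (C := 2 * E) (norm_nonneg _) <|
      (tendsto_pow_atTop_atTop_of_one_lt one_lt_two).frequently (.of_forall fun m ↦ ?_)
    calc ‖y‖ ^ 2 ^ m = ‖y ^ 2 ^ m‖ := (hsa.norm_pow_two_pow m).symm
      _ ≤ (2 * ↑(E * 2 ^ m) + 1) * ‖π (y ^ 2 ^ m)‖ :=
        norm_le_mul_norm_map_of_mem_laurentSpan hτ hUV hω π (laurentSpan.pow_mem hUV hy _)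
      _ ≤ (2 * E * (2 ^ m : ℕ) + 1) * ‖π y‖ ^ 2 ^ m := by
        rw [Nat.cast_mul, ← mul_assoc, map_pow]
        gcongr
        exact norm_pow_le' _ (Nat.two_pow_pos m)
  have key := norm_le_of_isSelfAdjoint (laurentSpan.mul_mem hUV (laurentSpan.star_mem hUV hx) hx)
    (.star_mul_self x)
  rw [map_mul, map_star, CStarRing.norm_star_mul_self, CStarRing.norm_star_mul_self] at key
  exact (mul_self_le_mul_self_iff (norm_nonneg _) (norm_nonneg _)).2 key

theorem isometry_of_isTracialState (hgen : generatedCStar (U : R) V = ⊤) : Isometry π := by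
  have π_continuous : Continuous π :=
    AddMonoidHomClass.continuous_of_bound π 1 fun x ↦ by
      simpa only [one_mul] using NonUnitalStarAlgHom.norm_apply_le π x
  refine AddMonoidHomClass.isometry_of_norm π fun x ↦
    (NonUnitalStarAlgHom.norm_apply_le π x).antisymm ?_
  have hx : x ∈ generatedCStar (U : R) V := hgen ▸ trivial
  refine closure_minimal (fun y hy ↦ ?_)
    (isClosed_le continuous_norm (continuous_norm.comp π_continuous)) hx
  obtain ⟨D, hD⟩ := laurentSpan.exists_mem_of_mem_adjoin hUV hy
  exact norm_le_norm_map_of_mem_laurentSpan hτ hUV hω π hD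

end TracialHomomorphism

/-- The scalar `e^{2πiθ}` as an element of the unitary group of `ℂ`. -/
noncomputable def rotationPhase (θ : ℝ) : unitary ℂ :=
  ⟨Complex.exp (2 * Real.pi * Complex.I * θ), by
    rw [Unitary.mem_iff_star_mul_self, Complex.star_def, ← Complex.exp_conj, ← Complex.exp_add]
    simp [Complex.conj_ofNat]⟩

lemma exists_rotationPhase_eq (ω : unitary ℂ) : ∃ θ : ℝ, rotationPhase θ = ω := by
  have norm_ω : ‖(ω : ℂ)‖ = 1 := CStarRing.norm_coe_unitary ω
  have two_pi_ne_zero : (2 * Real.pi : ℂ) ≠ 0 := by exact_mod_cast Real.two_pi_pos.ne'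
  refine ⟨Complex.arg ω / (2 * Real.pi), Subtype.ext ?_⟩
  calc Complex.exp (2 * Real.pi * Complex.I * ↑(Complex.arg ω / (2 * Real.pi)))
      = Complex.exp (Complex.arg ω * Complex.I) := by
        push_cast
        rw [mul_right_comm, mul_div_cancel₀ _ two_pi_ne_zero]
    _ = ω := by simpa only [norm_ω, Complex.ofReal_one, one_mul] using
      Complex.norm_mul_exp_arg_mul_I ω

lemma irrational_of_orderOf_rotationPhase_eq_zero {θ : ℝ} (hθ : orderOf (rotationPhase θ) = 0) :
    Irrational θ := by
  rintro ⟨q, rfl⟩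
  have den_mul : (q.den : ℂ) * q = q.num := by exact_mod_cast Rat.den_mul_eq_num q
  have pow_den : rotationPhase q ^ q.den = 1 := by
    refine Subtype.ext ?_
    change Complex.exp (2 * Real.pi * Complex.I * (q : ℝ)) ^ q.den = 1
    rw [← Complex.exp_nat_mul, Complex.exp_eq_one_iff]
    refine ⟨q.num, ?_⟩
    rw [Complex.ofReal_ratCast, ← den_mul]
    ring
  exact q.den_ne_zero (zero_dvd_iff.1 (hθ ▸ orderOf_dvd_of_pow_eq_one pow_den))

namespace FreeUnitaryPair

variable {θ : ℝ} {B : Type*} [CStarAlgebra B] (u v : unitary B)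

/-- The homomorphism out of the free ⋆-algebra on two unitaries sending the generators to `u` and
`v`. -/
noncomputable def liftAlgHom : FreeUnitaryPair θ →ₐ[ℂ] B :=
  MonoidAlgebra.lift ℂ B (FreeGroup (Fin 2)) ((unitary B).subtype.comp (FreeGroup.lift ![u, v]))

lemma liftAlgHom_single (g : FreeGroup (Fin 2)) (c : ℂ) :
    liftAlgHom u v (single θ g c) = c • (↑(FreeGroup.lift ![u, v] g) : B) :=
  MonoidAlgebra.lift_single ..

lemma liftAlgHom_genU : liftAlgHom u v (genU θ) = u := by
  rw [genU, liftAlgHom_single, one_smul, FreeGroup.lift_apply_of, Matrix.cons_val_zero]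

lemma liftAlgHom_genV : liftAlgHom u v (genV θ) = v := by
  rw [genV, liftAlgHom_single, one_smul, FreeGroup.lift_apply_of, Matrix.cons_val_one,
    Matrix.cons_val_fin_one]

lemma liftAlgHom_star (x : FreeUnitaryPair θ) :
    liftAlgHom u v (star x) = star (liftAlgHom u v x) := by
  induction x using induction_single with
  | h0 => rw [star_zero, map_zero, star_zero]
  | hs g c =>
    rw [star_single, liftAlgHom_single, liftAlgHom_single, star_smul, map_inv,
      ← Unitary.star_eq_inv, Unitary.coe_star]
  | ha x y hx hy => rw [star_add, map_add, hx, hy, map_add, star_add]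

variable {u v} (huv : u * v = rotationPhase θ • (v * u))

include huv

lemma isRotationSeminorm_liftAlgHom :
    IsRotationSeminorm ((normSeminorm ℂ B).comp (liftAlgHom (θ := θ) u v).toLinearMap) where
  mul_le x y := by
    simpa only [Seminorm.comp_apply, AlgHom.toLinearMap_apply, coe_normSeminorm, map_mul] using
      norm_mul_le _ _
  star_mul_self x := by
    simp only [Seminorm.comp_apply, AlgHom.toLinearMap_apply, coe_normSeminorm, map_mul,
      liftAlgHom_star, CStarRing.norm_star_mul_self, sq]
  relation := by
    simp only [Seminorm.comp_apply, AlgHom.toLinearMap_apply, coe_normSeminorm, map_sub, map_smul,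
      map_mul, liftAlgHom_genU, liftAlgHom_genV]
    rw [norm_eq_zero, sub_eq_zero]
    exact congrArg Subtype.val huv

lemma norm_liftAlgHom_le (x : FreeUnitaryPair θ) : ‖liftAlgHom u v x‖ ≤ ‖x‖ :=
  le_univNorm (isRotationSeminorm_liftAlgHom huv) x

end FreeUnitaryPair

namespace RotationAlgebra

open UniformSpace FreeUnitaryPair

variable {θ : ℝ}

lemma mk_one : mk (1 : FreeUnitaryPair θ) = 1 := Completion.coe_one _

/-- The unitary of the rotation algebra represented by a word in the generators. -/
noncomputable def word (θ : ℝ) : FreeGroup (Fin 2) →* unitary (RotationAlgebra θ) where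
  toFun g := ⟨mk (single θ g 1), by
    rw [Unitary.mem_iff, ← mk_star, star_single, ← mk_mul, ← mk_mul, single_mul_single,
      single_mul_single, star_one, mul_one, inv_mul_cancel, mul_inv_cancel, ← one_def, mk_one]
    exact ⟨rfl, rfl⟩⟩
  map_one' := Subtype.ext mk_one
  map_mul' g h := Subtype.ext <|
    (congrArg mk (by rw [single_mul_single, mul_one])).trans
      (mk_mul (single θ g 1) (single θ h 1))

/-- The first generating unitary of the rotation algebra. -/
noncomputable def unitaryU (θ : ℝ) : unitary (RotationAlgebra θ) := word θ (.of 0)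

/-- The second generating unitary of the rotation algebra. -/
noncomputable def unitaryV (θ : ℝ) : unitary (RotationAlgebra θ) := word θ (.of 1)

lemma unitaryU_mul_unitaryV :
    unitaryU θ * unitaryV θ = rotationPhase θ • (unitaryV θ * unitaryU θ) := by
  let c : ℂ := rotationPhase θ
  have norm_le_zero : ‖mk (genU θ * genV θ + -c • (genV θ * genU θ))‖ ≤ 0 := by
    rw [norm_mk, neg_smul, ← sub_eq_add_neg]
    exact univNorm_le fun p hp ↦ hp.relation.le
  rw [norm_le_zero_iff, mk_add, mk_smul, neg_smul, ← sub_eq_add_neg, sub_eq_zero, mk_mul,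
    mk_mul] at norm_le_zero
  exact Subtype.ext norm_le_zero

lemma word_mem {S : StarSubalgebra ℂ (RotationAlgebra θ)}
    (hU : (unitaryU θ : RotationAlgebra θ) ∈ S) (hV : (unitaryV θ : RotationAlgebra θ) ∈ S)
    (g : FreeGroup (Fin 2)) : (word θ g : RotationAlgebra θ) ∈ S := by
  induction g using FreeGroup.induction_on with
  | C1 => rw [map_one]; exact one_mem S
  | of i => fin_cases i <;> assumption
  | inv_of i hi => rw [map_inv, ← Unitary.star_eq_inv]; exact star_mem hi
  | mul g h hg hh => rw [map_mul]; exact mul_mem hg hh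

lemma generatedCStar_unitaryU_unitaryV :
    generatedCStar (unitaryU θ : RotationAlgebra θ) (unitaryV θ) = ⊤ := by
  let S := StarAlgebra.adjoin ℂ {(unitaryU θ : RotationAlgebra θ), ↑(unitaryV θ)}
  have mk_mem (x : FreeUnitaryPair θ) : mk x ∈ S := by
    induction x using induction_single with
    | h0 =>
      have : mk (0 : FreeUnitaryPair θ) = 0 := Completion.coe_zero
      exact this ▸ zero_mem S
    | hs g c =>
      have : mk (single θ g c) = c • (word θ g : RotationAlgebra θ) :=
        (congrArg mk (by rw [smul_single, mul_one])).trans (mk_smul c (single θ g 1))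
      rw [this]
      exact S.smul_mem (word_mem (StarAlgebra.subset_adjoin ℂ _ (.inl rfl))
        (StarAlgebra.subset_adjoin ℂ _ (.inr rfl)) g) c
    | ha x y hx hy => rw [mk_add]; exact add_mem hx hy
  refine top_le_iff.1 fun x _ ↦ ?_
  exact closure_mono (Set.range_subset_iff.2 mk_mem) (denseRange_mk x)

theorem exists_starAlgHom {B : Type*} [CStarAlgebra B] {u v : unitary B}
    (huv : u * v = rotationPhase θ • (v * u)) :
    ∃ π : RotationAlgebra θ →⋆ₐ[ℂ] B, π (unitaryU θ) = u ∧ π (unitaryV θ) = v := by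
  let φ : FreeUnitaryPair θ →ₐ[ℂ] B := liftAlgHom u v
  have φ_continuous : Continuous (φ : FreeUnitaryPair θ →+* B) :=
    AddMonoidHomClass.continuous_of_bound φ 1 fun x ↦ by
      simpa only [one_mul] using norm_liftAlgHom_le huv x
  let ρ : RotationAlgebra θ →+* B := Completion.extensionHom _ φ_continuous
  have ρ_mk (x : FreeUnitaryPair θ) : ρ (mk x) = liftAlgHom u v x :=
    Completion.extensionHom_coe _ φ_continuous x
  have ρ_continuous : Continuous ρ := Completion.continuous_extension
  have ρ_algebraMap (c : ℂ) : ρ (algebraMap ℂ _ c) = algebraMap ℂ B c := by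
    rw [Algebra.algebraMap_eq_smul_one, ← mk_one, ← mk_smul, ρ_mk, map_smul, map_one,
      Algebra.algebraMap_eq_smul_one]
  have ρ_star (x : RotationAlgebra θ) : ρ (star x) = star (ρ x) := by
    refine denseRange_mk.induction_on x (isClosed_eq (ρ_continuous.comp continuous_star')
      (continuous_star.comp ρ_continuous)) fun a ↦ ?_
    rw [← mk_star, ρ_mk, ρ_mk, liftAlgHom_star]
  exact ⟨{ ρ with commutes' := ρ_algebraMap, map_star' := ρ_star },
    (ρ_mk _).trans (liftAlgHom_genU u v), (ρ_mk _).trans (liftAlgHom_genV u v)⟩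

end RotationAlgebra

section Classification

variable {B : Type*} [CStarAlgebra B] {u v : unitary B}

theorem nonempty_starAlgEquiv_rotationAlgebra (hgen : generatedCStar (u : B) v = ⊤) {θ : ℝ}
    (huv : u * v = rotationPhase θ • (v * u)) (hθ : orderOf (rotationPhase θ) = 0)
    {τ : B →ₗ[ℂ] ℂ} (hτ : IsTracialState τ) : Nonempty (B ≃⋆ₐ[ℂ] RotationAlgebra θ) := by
  obtain ⟨π, hπu, hπv⟩ := RotationAlgebra.exists_starAlgHom huv
  have π_isometry : Isometry π := isometry_of_isTracialState hτ
    RotationAlgebra.unitaryU_mul_unitaryV hθ π RotationAlgebra.generatedCStar_unitaryU_unitaryV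
  have π_surjective : Function.Surjective π := generatedCStar.surjective_of_mem_range hgen π
    π_isometry.isClosedEmbedding.isClosed_range ⟨_, hπu⟩ ⟨_, hπv⟩
  exact ⟨(StarAlgEquiv.ofBijective π ⟨π_isometry.injective, π_surjective⟩).symm⟩

theorem exists_starAlgEquiv_of_existsUnique_isTracialState (hgen : generatedCStar (u : B) v = ⊤)
    (hu : Commute ⁅u, v⁆ u) (hv : Commute ⁅u, v⁆ v)
    (hτ : ∃! τ : B →ₗ[ℂ] ℂ, IsTracialState τ) :
    (∃ θ : ℝ, Irrational θ ∧ Nonempty (B ≃⋆ₐ[ℂ] RotationAlgebra θ)) ∨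
      ∃ n : ℕ, 1 ≤ n ∧ Nonempty (B ≃⋆ₐ[ℂ] Matrix (Fin n) (Fin n) ℂ) := by
  obtain ⟨ω, huv⟩ := exists_mul_eq_smul_mul hgen hu hv hτ
  by_cases hω : orderOf ω = 0
  · obtain ⟨θ, rfl⟩ := exists_rotationPhase_eq ω
    obtain ⟨τ, hτ, -⟩ := hτ
    exact .inl ⟨θ, irrational_of_orderOf_rotationPhase_eq_zero hω,
      nonempty_starAlgEquiv_rotationAlgebra hgen huv hω hτ⟩
  · exact .inr ⟨orderOf ω, Nat.one_le_iff_ne_zero.2 hω,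
      nonempty_starAlgEquiv_matrix hgen huv hω hτ⟩

end Classification

lemma generatedCStar.eq_top_of_coe_eq {A : Type*} [CStarAlgebra A] {S : StarSubalgebra ℂ A}
    [hS : IsClosed (S : Set A)] {u v : S} (h : generatedCStar (u : A) v = S) :
    generatedCStar u v = ⊤ := by
  let T : StarSubalgebra ℂ A := (generatedCStar u v).map S.subtype
  have isClosed_T : IsClosed (T : Set A) :=
    hS.isClosedEmbedding_subtypeVal.isClosedMap _ (isClosed (u := u) (v := v))
  have S_le_T : S ≤ T := h.symm.trans_le <| (le_iff isClosed_T).2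
    ⟨⟨u, left_mem, rfl⟩, ⟨v, right_mem, rfl⟩⟩
  refine top_le_iff.1 fun x _ ↦ ?_
  obtain ⟨y, hy, hyx⟩ := S_le_T x.2
  exact Subtype.ext hyx ▸ hy

theorem corollary3p8_general {A : Type*} [CStarAlgebra A] (u v : A)
    (hu : u ∈ unitary A) (hv : v ∈ unitary A)
    (hcu : Commute (u * v * star u * star v) u)
    (hcv : Commute (u * v * star u * star v) v)
    (hτ : ∃! τ : generatedCStar u v →ₗ[ℂ] ℂ, IsTracialState τ) :
    (∃ θ : ℝ, Irrational θ ∧ Nonempty (generatedCStar u v ≃⋆ₐ[ℂ] RotationAlgebra θ)) ∨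
    (∃ n : ℕ, 1 ≤ n ∧ Nonempty (generatedCStar u v ≃⋆ₐ[ℂ] Matrix (Fin n) (Fin n) ℂ)) := by
  have := generatedCStar.isClosed (u := u) (v := v)
  let u' : unitary (generatedCStar u v) :=
    ⟨⟨u, generatedCStar.left_mem⟩, Subtype.ext hu.1, Subtype.ext hu.2⟩
  let v' : unitary (generatedCStar u v) :=
    ⟨⟨v, generatedCStar.right_mem⟩, Subtype.ext hv.1, Subtype.ext hv.2⟩
  exact exists_starAlgEquiv_of_existsUnique_isTracialState (u := u') (v := v')
    (generatedCStar.eq_top_of_coe_eq rfl) (Subtype.ext (Subtype.ext hcu))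
    (Subtype.ext (Subtype.ext hcv)) hτ

theorem corollary3p8 {A : Type*} [CStarAlgebra A] (u v : A)
    (hu : u ∈ unitary A) (hv : v ∈ unitary A)
    (huv : ‖u * v - v * u‖ < 2)
    (hcu : Commute (u * v * star u * star v) u)
    (hcv : Commute (u * v * star u * star v) v)
    (hτ : ∃! τ : generatedCStar u v →ₗ[ℂ] ℂ, IsTracialState τ) :
    (∃ θ : ℝ, Irrational θ ∧ Nonempty (generatedCStar u v ≃⋆ₐ[ℂ] RotationAlgebra θ)) ∨
    (∃ n : ℕ, 1 ≤ n ∧ Nonempty (generatedCStar u v ≃⋆ₐ[ℂ] Matrix (Fin n) (Fin n) ℂ)) :=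
  corollary3p8_general u v hu hv hcu hcv hτ
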